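/- Let $d\ge 1$, let $\Omega\subset\mathbb{R}^d$ be a nonempty bounded open set (for instance a bounded Lipschitz, locally star-shaped domain), and let $a>0$, $b\in\mathbb{R}\setminus\{0\}$. Let $\Delta$ be the Dirichlet Laplacian on $L^2(\Omega;\mathbb{R})$, i.e. $u$ is in its domain and $\Delta u=f$ if and only if $u\in H^1_0(\Omega;\mathbb{R})$, $f\in L^2(\Omega;\mathbb{R})$ and $\int_\Omega\nabla u\cdot\nabla\varphi\,dx=-\int_\Omega f\varphi\,dx$ for all $\varphi\in C_c^\infty(\Omega)$. On $L^2(\Omega;\mathbb{R}^2)$ consider the operator $$\mathcal{A}=\begin{pmatrix}a\Delta&-b\Delta\\ b\Delta&a\Delta\end{pmatrix},\qquad D(\mathcal{A})=D(\Delta)\times D(\Delta),$$ and let $B=(1,0)$, i.e. $B(z_1,z_2)^\top=z_1$. Then $\mathcal{A}$ generates exactly one strongly continuous semigroup $\{e^{\mathcal{A}t}\}_{t\ge0}$ on $L^2(\Omega;\mathbb{R}^2)$, and for every $T>0$ and every integer $m\ge1$ there exist distinct times $S_1,\dots,S_m\in(0,T)$ and $z\in L^2(\Omega;\mathbb{R}^2)\setminus\{0\}$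 such that $$Be^{\mathcal{A}S_i}z=0\qquad\text{for all } i\in\{1,\dots,m\}.$$ Moreover, these can be chosen so that $z=(v_1,v_2)^\top e$ with $v_1,v_2\in\mathbb{R}$ and $e$ an eigenfunction of $-\Delta$ for an eigenvalue $\lambda>0$, and $$S_i-S_j=(i-j)\,\frac{2\pi}{b\lambda}\qquad\text{for all } i,j\in\{1,\dots,m\},$$ and so that no interpolation observability inequality holds at these times: for all measurable sets $\omega_1,\dots,\omega_m\subset\Omega$ of positive Lebesgue measure, all $p\in[1,2]$ and all $\theta\in(0,1)$, there is no constant $C>0$ with $$\|e^{\mathcal{A}T}y\|_{L^2(\Omega;\mathbb{R}^2)}\le C\Big(\sum_{i=1}^m\|\chi_{\omega_i}Be^{\mathcal{A}S_i}y\|_{L^p(\Omega;\mathbb{R})}\Big)^{1-\theta}\|y\|_{L^2(\Omega;\mathbb{R}^2)}^{\theta}\qquad\text{for all } y\in L^2(\Omega;\mathbb{R}^2).$$ -/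

import Mathlib

open MeasureTheory Filter Topology Distributions
open scoped NNReal ENNReal

namespace StronglyCoupled

/-- `L²(Ω; ℝ)` with Lebesgue measure. -/
abbrev L2 {d : ℕ} (Ω : TopologicalSpace.Opens (EuclideanSpace ℝ (Fin d))) : Type :=
  Lp ℝ 2 ((volume : Measure (EuclideanSpace ℝ (Fin d))).restrict Ω)

/-- `L²(Ω; ℝ^d)`, the space of square integrable vector fields on `Ω`. -/
abbrev L2Field {d : ℕ} (Ω : TopologicalSpace.Opens (EuclideanSpace ℝ (Fin d))) : Type :=
  Lp (EuclideanSpace ℝ (Fin d)) 2 ((volume : Measure (EuclideanSpace ℝ (Fin d))).restrict Ω)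

/-- The state space `L²(Ω; ℝ²)`: pairs `(z₁, z₂)` of functions in `L²(Ω; ℝ)` with the Hilbert norm
`(‖z₁‖² + ‖z₂‖²)^(1/2)`. -/
abbrev State {d : ℕ} (Ω : TopologicalSpace.Opens (EuclideanSpace ℝ (Fin d))) : Type :=
  WithLp 2 (L2 Ω × L2 Ω)

/-- The state `(z₁, z₂)`. -/
def mkState {d : ℕ} {Ω : TopologicalSpace.Opens (EuclideanSpace ℝ (Fin d))}
    (z₁ z₂ : L2 Ω) : State Ω :=
  WithLp.toLp 2 (z₁, z₂)

/-- The set of pairs `(φ, ∇φ)` with `φ` a smooth function compactly supported in `Ω`, as elements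
of `L²(Ω; ℝ) × L²(Ω; ℝ^d)`. -/
def testGraph {d : ℕ} (Ω : TopologicalSpace.Opens (EuclideanSpace ℝ (Fin d))) :
    Set (L2 Ω × L2Field Ω) :=
  {q | ∃ φ : 𝓓(Ω, ℝ),
    q.1 =ᵐ[volume.restrict (Ω : Set (EuclideanSpace ℝ (Fin d)))] φ ∧
    q.2 =ᵐ[volume.restrict (Ω : Set (EuclideanSpace ℝ (Fin d)))] gradient φ}

/-- `u ∈ H¹₀(Ω; ℝ)` with weak gradient `g`: the pair `(u, g)` is a limit in `L²` of pairs
`(φ, ∇φ)` of test functions and their gradients, so `u` is an `H¹`-limit of test functions. -/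
def IsH10WithGradient {d : ℕ} (Ω : TopologicalSpace.Opens (EuclideanSpace ℝ (Fin d)))
    (u : L2 Ω) (g : L2Field Ω) : Prop :=
  (u, g) ∈ closure (testGraph Ω)

/-- The graph of the Dirichlet Laplacian on `L²(Ω; ℝ)`: `u ∈ H¹₀(Ω; ℝ)`, and `Δu = f ∈ L²(Ω; ℝ)`
in the weak sense, `∫_Ω ∇u · ∇φ = - ∫_Ω f φ` for every test function `φ`. -/
def HasDirichletLaplacian {d : ℕ} (Ω : TopologicalSpace.Opens (EuclideanSpace ℝ (Fin d)))
    (u f : L2 Ω) : Prop :=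
  ∃ g : L2Field Ω, IsH10WithGradient Ω u g ∧
    ∀ φ : 𝓓(Ω, ℝ),
      ∫ x in (Ω : Set (EuclideanSpace ℝ (Fin d))), inner ℝ (g x) (gradient φ x) =
        - ∫ x in (Ω : Set (EuclideanSpace ℝ (Fin d))), f x * φ x

/-- `e` is an eigenfunction of `-Δ`, with homogeneous Dirichlet boundary condition, for the
eigenvalue `lam`. -/
def IsDirichletEigenfunction {d : ℕ} (Ω : TopologicalSpace.Opens (EuclideanSpace ℝ (Fin d)))
    (lam : ℝ) (e : L2 Ω) : Prop :=
  e ≠ 0 ∧ HasDirichletLaplacian Ω e (-(lam • e))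

/-- The graph of the operator `(aΔ, -bΔ; bΔ, aΔ)` on `L²(Ω; ℝ²)` with Dirichlet boundary condition:
the state `z` is in the domain and is mapped to `w`. -/
def HasCoupledLaplacian {d : ℕ} (Ω : TopologicalSpace.Opens (EuclideanSpace ℝ (Fin d)))
    (a b : ℝ) (z w : State Ω) : Prop :=
  ∃ f₁ f₂ : L2 Ω, HasDirichletLaplacian Ω z.fst f₁ ∧ HasDirichletLaplacian Ω z.snd f₂ ∧
    w = mkState (a • f₁ - b • f₂) (b • f₁ + a • f₂)

/-- Strongly continuous one-parameter semigroups of bounded operators on a normed space. -/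
structure IsC0Semigroup {X : Type*} [NormedAddCommGroup X] [NormedSpace ℝ X]
    (S : ℝ≥0 → X →L[ℝ] X) : Prop where
  map_zero : S 0 = ContinuousLinearMap.id ℝ X
  map_add : ∀ s t : ℝ≥0, S (s + t) = (S s).comp (S t)
  continuous_orbit : ∀ x : X, Continuous fun t : ℝ≥0 => S t x

/-- `S` is the strongly continuous semigroup `t ↦ e^{t𝒜}` generated by the (unbounded) operator
`𝒜` with graph `G`: the operator `x ↦ lim_{h → 0+} (S(h)x - x)/h`, defined exactly for the `x`
for which this limit exists, has graph `G`. -/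
structure IsSemigroupGeneratedBy {X : Type*} [NormedAddCommGroup X] [NormedSpace ℝ X]
    (G : X → X → Prop) (S : ℝ≥0 → X →L[ℝ] X) : Prop where
  isC0Semigroup : IsC0Semigroup S
  generator_iff : ∀ x y : X,
    G x y ↔ Tendsto (fun h : ℝ≥0 => (h : ℝ)⁻¹ • (S h x - x)) (𝓝[>] 0) (𝓝 y)

/-- The observation operator `B = (1, 0)`: the first component of a state. -/
def observe {d : ℕ} {Ω : TopologicalSpace.Opens (EuclideanSpace ℝ (Fin d))} (z : State Ω) : L2 Ω :=
  z.fst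

/-- The interpolation observability inequality at the times `τ i`, with observation sets `ω i`,
observations measured in the `L^p` norm, interpolation exponent `θ` and constant `C`:
`‖S(T)z‖ ≤ C (∑ i, ‖χ_{ω i} B S(τ i)z‖_{L^p})^(1-θ) ‖z‖^θ` for all states `z`. -/
def InterpolationObservability {d : ℕ} {Ω : TopologicalSpace.Opens (EuclideanSpace ℝ (Fin d))}
    (S : ℝ≥0 → State Ω →L[ℝ] State Ω) (T : ℝ≥0) {m : ℕ} (τ : Fin m → ℝ≥0)
    (ω : Fin m → Set (EuclideanSpace ℝ (Fin d))) (p : ℝ≥0∞) (θ C : ℝ) : Prop :=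
  ∀ z : State Ω, ‖S T z‖ ≤
    C * (∑ i, (eLpNorm (observe (S (τ i) z)) p (volume.restrict (ω i))).toReal) ^ (1 - θ)
      * ‖z‖ ^ θ

end StronglyCoupled

/-!
The Dirichlet form is closed, and by Rellich's theorem its domain embeds compactly into `L²(Ω)`, so
`L²(Ω)` has a Hilbert basis of Dirichlet eigenfunctions, whose eigenvalues are unbounded. Writing
`(z₁, z₂)` as `z₁ + i z₂` turns the coupled operator into `(a + ib)Δ`, which is diagonal in that
basis: the mode of eigenvalue `λ` evolves by `exp (-(a + ib)λt)`. The semigroup is therefore an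
explicit diagonal one, and a mode that is purely imaginary at one time is again purely imaginary
after every multiple of `2π / (bλ)`. For large `λ` this period is so short that `m` such times fit
into `(0, T)`. At these times the first component vanishes, while the mode itself never does, so
that the interpolation inequality would bound a nonzero norm by zero.
-/

namespace StronglyCoupled

section SequenceSpaces

variable {ι 𝕜 A : Type*} {p : ℝ≥0∞} [Fact (1 ≤ p)]

theorem tendsto_lp_of_dominated {α : Type*} {E F : ι → Type*} [∀ i, NormedAddCommGroup (E i)]
    [∀ i, NormedAddCommGroup (F i)] (hp : p ≠ ∞) {l : Filter α} {u : α → lp E p} {v : lp E p}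
    (g : lp F p) (hg : ∀ᶠ n in l, ∀ i, ‖u n i‖ ≤ ‖g i‖)
    (hu : ∀ i, Tendsto (fun n => u n i) l (𝓝 (v i))) : Tendsto u l (𝓝 v) := by
  rcases l.eq_or_neBot with rfl | _
  · exact tendsto_bot
  have hp0 : 0 < p.toReal := ENNReal.toReal_pos (zero_lt_one.trans_le Fact.out).ne' hp
  have hv (i : ι) : ‖v i‖ ≤ ‖g i‖ := le_of_tendsto (hu i).norm (hg.mono fun n hn => hn i)
  have hsum : Summable fun i => (2 * ‖g i‖) ^ p.toReal := by
    simp_rw [Real.mul_rpow zero_le_two (norm_nonneg _)]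
    exact (lp.hasSum_norm hp0 g).summable.mul_left _
  have hlim (i : ι) : Tendsto (fun n => ‖(u n - v) i‖ ^ p.toReal) l (𝓝 0) := by
    simpa [hp0.ne'] using
      (tendsto_iff_norm_sub_tendsto_zero.1 (hu i)).rpow_const (p := p.toReal) (Or.inr hp0.le)
  have hbound : ∀ᶠ n in l, ∀ i, ‖‖(u n - v) i‖ ^ p.toReal‖ ≤ (2 * ‖g i‖) ^ p.toReal := by
    filter_upwards [hg] with n hn i
    rw [Real.norm_of_nonneg (by positivity)]
    gcongr
    calc ‖(u n - v) i‖ ≤ ‖u n i‖ + ‖v i‖ := norm_sub_le _ _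
      _ ≤ 2 * ‖g i‖ := by linarith [hn i, hv i]
  rw [tendsto_iff_norm_sub_tendsto_zero]
  simp_rw [lp.norm_eq_tsum_rpow hp0]
  simpa [hp0.ne'] using
    (tendsto_tsum_of_dominated_convergence hsum hlim hbound).rpow_const (p := 1 / p.toReal)
      (Or.inr (by positivity))

variable [NormedField 𝕜] [NormedRing A] [NormedAlgebra 𝕜 A]

/-- Multiplication by the family `c`, bounded by `1`, as a contraction of the sequence space
`ℓ^p`. -/
noncomputable def multiplier (c : ι → A) (hc : ∀ i, ‖c i‖ ≤ 1) :
    lp (fun _ : ι => A) p →L[𝕜] lp (fun _ : ι => A) p :=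
  have hle (f : lp (fun _ : ι => A) p) (i : ι) : ‖c i * f i‖ ≤ ‖f i‖ :=
    (norm_mul_le _ _).trans (mul_le_of_le_one_left (norm_nonneg _) (hc i))
  LinearMap.mkContinuous
    { toFun := fun f => ⟨fun i => c i * f i, (lp.memℓp f).mono' (hle f)⟩
      map_add' := fun _ _ => lp.ext (funext fun _ => mul_add _ _ _)
      map_smul' := fun _ _ => lp.ext (funext fun _ => mul_smul_comm _ _ _) }
    1 fun f => (one_mul ‖f‖).symm ▸ lp.norm_mono (zero_lt_one.trans_le Fact.out).ne' (hle f)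

@[simp]
theorem multiplier_apply (c : ι → A) (hc : ∀ i, ‖c i‖ ≤ 1) (f : lp (fun _ : ι => A) p) (i : ι) :
    (multiplier c hc : _ →L[𝕜] _) f i = c i * f i :=
  rfl

end SequenceSpaces

section HilbertBases

universe u v

variable {ι : Type*} {𝕜 : Type v} {H : Type u} [RCLike 𝕜] [NormedAddCommGroup H]
  [InnerProductSpace 𝕜 H]

theorem ext_inner_hilbertBasis (e : HilbertBasis ι 𝕜 H) {x y : H}
    (h : ∀ i, inner 𝕜 (e i) x = inner 𝕜 (e i) y) : x = y :=
  e.repr.injective <| lp.ext <| funext fun i => by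
    rw [e.repr_apply_apply, e.repr_apply_apply, h i]

theorem exists_norm_eigenvalue_lt {K : H →L[𝕜] H} (hK : IsCompactOperator K)
    (hinf : ¬ FiniteDimensional 𝕜 H) (e : HilbertBasis ι 𝕜 H) {μ : ι → 𝕜}
    (hKe : ∀ x i, inner 𝕜 (e i) (K x) = μ i * inner 𝕜 (e i) x)
    {δ : ℝ} (hδ : 0 < δ) : ∃ i, ‖μ i‖ < δ := by
  by_contra! hμ
  have hμ0 (i : ι) : μ i ≠ 0 := norm_pos_iff.1 (hδ.trans_le (hμ i))
  have hc (i : ι) : ‖(δ : 𝕜) / μ i‖ ≤ 1 := by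
    rw [norm_div, RCLike.norm_ofReal, abs_of_pos hδ]
    exact div_le_one_of_le₀ (hμ i) (norm_nonneg _)
  let D : H →L[𝕜] H :=
    (e.repr.symm : _ →L[𝕜] H) ∘L multiplier (p := 2) _ hc ∘L (e.repr : H →L[𝕜] _)
  have hDK : ⇑(D ∘L K) = (δ : 𝕜) • (id : H → H) := by
    funext x
    refine ext_inner_hilbertBasis e fun i => ?_
    have hD (y : H) : inner 𝕜 (e i) (D y) = δ / μ i * inner 𝕜 (e i) y := by
      simp [D, ← e.repr_apply_apply]
    rw [ContinuousLinearMap.comp_apply, hD, hKe, Pi.smul_apply, id, inner_smul_right, ← mul_assoc,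
      div_mul_cancel₀ _ (hμ0 i)]
  have hcomp : IsCompactOperator ⇑(D ∘L K) := hK.clm_comp D
  rw [hDK, IsCompactOperator.smul_iff₀ (RCLike.ofReal_ne_zero.2 hδ.ne')] at hcomp
  exact hinf (FiniteDimensional.of_isCompactOperator_id hcomp)

variable [CompleteSpace H]

theorem exists_hilbertBasis_of_orthogonalFamily {κ : Type v} (V : κ → Submodule 𝕜 H)
    [∀ k, CompleteSpace (V k)]
    (hV : OrthogonalFamily 𝕜 (fun k => V k) fun k => (V k).subtypeₗᵢ) (hbot : (⨆ k, V k)ᗮ = ⊥) :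
    ∃ (ι : Type (max u v)) (e : HilbertBasis ι 𝕜 H), ∀ i, ∃ k, e i ∈ V k := by
  choose w v _ using fun k => exists_hilbertBasis 𝕜 (V k)
  have hon := hV.orthonormal_sigma_orthonormal
    (v_family := fun k => (v k : w k → V k)) (fun k => (v k).orthonormal)
  suffices hspan : (Submodule.span 𝕜
      (Set.range fun a : Σ k, w k => (V a.1).subtypeₗᵢ (v a.1 a.2)))ᗮ = ⊥ by
    refine ⟨_, HilbertBasis.mkOfOrthogonalEqBot hon hspan, fun a => ⟨a.1, ?_⟩⟩
    rw [HilbertBasis.coe_mkOfOrthogonalEqBot]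
    exact (v a.1 a.2).2
  rw [eq_bot_iff, ← hbot, ← Submodule.iInf_orthogonal]
  intro x hx
  rw [Submodule.mem_orthogonal'] at hx
  refine (Submodule.mem_iInf _).2 fun k => (Submodule.mem_orthogonal' _ _).2 fun y hy => ?_
  have hzero : innerSL 𝕜 x ∘L (V k).subtypeL = 0 :=
    ContinuousLinearMap.ext_on
      (Submodule.dense_iff_topologicalClosure_eq_top.2 (v k).dense_span) <| by
      rintro _ ⟨i, rfl⟩
      exact hx _ (Submodule.subset_span ⟨⟨k, i⟩, rfl⟩)
  exact DFunLike.congr_fun hzero ⟨y, hy⟩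

theorem exists_hilbertBasis_eigenvectors {K : H →L[𝕜] H} (hK : IsCompactOperator K)
    (hs : K.IsSymmetric) :
    ∃ (ι : Type (max u v)) (e : HilbertBasis ι 𝕜 H) (μ : ι → 𝕜), ∀ i, K (e i) = μ i • e i := by
  have (μ : 𝕜) : CompleteSpace (Module.End.eigenspace (K : Module.End 𝕜 H) μ) :=
    (ContinuousLinearMap.isClosed_eigenspace K μ).completeSpace_coe
  obtain ⟨ι, e, he⟩ := exists_hilbertBasis_of_orthogonalFamily _ hs.orthogonalFamily_eigenspaces
    (ContinuousLinearMap.orthogonalComplement_iSup_eigenspaces_eq_bot hK hs)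
  choose μ hμ using he
  exact ⟨ι, e, μ, fun i => Module.End.mem_eigenspace_iff.1 (hμ i)⟩

end HilbertBases

section Semigroups

variable {X : Type*} [NormedAddCommGroup X] [NormedSpace ℝ X] {G : X → X → Prop}
  {S : ℝ≥0 → X →L[ℝ] X}

theorem IsSemigroupGeneratedBy.hasDerivWithinAt_orbit (hS : IsSemigroupGeneratedBy G S) {x y : X}
    (hxy : G x y) (t : ℝ≥0) :
    HasDerivWithinAt (fun s : ℝ => S s.toNNReal x) (S t y) (Set.Ici t) t := by
  have hquot : Tendsto (fun h : ℝ≥0 => S t ((h : ℝ)⁻¹ • (S h x - x))) (𝓝[>] 0) (𝓝 (S t y)) :=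
    ((S t).continuous.tendsto y).comp ((hS.generator_iff x y).1 hxy)
  rw [← hasDerivWithinAt_Ioi_iff_Ici, hasDerivWithinAt_iff_tendsto_slope' (by simp),
    ← add_zero (t : ℝ), ← map_add_left_nhdsGT, ← NNReal.coe_zero, ← NNReal.map_coe_nhdsGT,
    tendsto_map'_iff, tendsto_map'_iff]
  refine hquot.congr fun h => ?_
  simp [slope, Real.toNNReal_add, hS.isC0Semigroup.map_add, smul_sub]

theorem re_smul_map_one_add_im_smul_map_I (B : ℂ →L[ℝ] X) (w : ℂ) :
    w.re • B 1 + w.im • B Complex.I = B w := by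
  rw [← map_smul, ← map_smul, ← map_add, Complex.real_smul, Complex.real_smul, mul_one,
    Complex.re_add_im]

theorem IsC0Semigroup.continuous_complexLine (hS : IsC0Semigroup S) (J : ℂ →L[ℝ] X) {c : ℝ → ℂ}
    (hc : Continuous c) : Continuous fun s : ℝ => S s.toNNReal (J (c s)) := by
  have horbit (x : X) : Continuous fun s : ℝ => S s.toNNReal x :=
    (hS.continuous_orbit x).comp continuous_real_toNNReal
  refine Continuous.congr (((Complex.continuous_re.comp hc).smul (horbit (J 1))).add
    ((Complex.continuous_im.comp hc).smul (horbit (J Complex.I)))) fun s => ?_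
  exact re_smul_map_one_add_im_smul_map_I (S s.toNNReal ∘L J) (c s)

theorem IsSemigroupGeneratedBy.hasDerivWithinAt_complexLine (hS : IsSemigroupGeneratedBy G S)
    {μ : ℂ} {J : ℂ →L[ℝ] X} (hJ : ∀ v, G (J v) (J (μ * v))) {c : ℝ → ℂ} {c' : ℂ} {t : ℝ≥0}
    (hc : HasDerivAt c c' t) :
    HasDerivWithinAt (fun s : ℝ => S s.toNNReal (J (c s))) (S t (J (c' + μ * c t)))
      (Set.Ici t) t := by
  have hre := (Complex.reCLM.hasFDerivAt.comp_hasDerivAt _ hc).hasDerivWithinAt.smul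
    (hS.hasDerivWithinAt_orbit (hJ 1) t)
  have him := (Complex.imCLM.hasFDerivAt.comp_hasDerivAt _ hc).hasDerivWithinAt.smul
    (hS.hasDerivWithinAt_orbit (hJ Complex.I) t)
  convert hre.add him using 1
  · exact funext fun s => (re_smul_map_one_add_im_smul_map_I (S s.toNNReal ∘L J) (c s)).symm
  · have hc' := re_smul_map_one_add_im_smul_map_I (S t ∘L J) c'
    have hμc := re_smul_map_one_add_im_smul_map_I
      (S t ∘L J ∘L ContinuousLinearMap.mul ℝ ℂ μ) (c t)
    simp only [ContinuousLinearMap.comp_apply, ContinuousLinearMap.mul_apply'] at hc' hμc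
    rw [map_add, map_add, ← hc', ← hμc]
    simp only [mul_one, Function.comp_apply, Complex.reCLM_apply, Real.toNNReal_coe,
      Complex.imCLM_apply]
    abel

theorem IsSemigroupGeneratedBy.apply_complexLine (hS : IsSemigroupGeneratedBy G S) {μ : ℂ}
    {J : ℂ →L[ℝ] X} (hJ : ∀ v, G (J v) (J (μ * v))) (t : ℝ≥0) (v : ℂ) :
    S t (J v) = J (Complex.exp (t * μ) * v) := by
  let c (s : ℝ) : ℂ := Complex.exp ((t - s) * μ) * v
  have hc (s : ℝ) : HasDerivAt c (-(μ * c s)) s := by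
    have h : HasDerivAt (fun z : ℂ => (t - z) * μ) (-μ) (s : ℂ) := by
      simpa using ((hasDerivAt_id (s : ℂ)).const_sub (t : ℂ)).mul_const μ
    exact (h.cexp.mul_const v).comp_ofReal.congr_deriv (by simp only [c]; ring)
  have hderiv (s : ℝ) (hs : 0 ≤ s) :
      HasDerivWithinAt (fun s : ℝ => S s.toNNReal (J (c s))) 0 (Set.Ici s) s := by
    lift s to ℝ≥0 using hs
    simpa using hS.hasDerivWithinAt_complexLine hJ (hc s)
  have hcont : Continuous fun s : ℝ => S s.toNNReal (J (c s)) :=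
    hS.isC0Semigroup.continuous_complexLine J
      (continuous_iff_continuousAt.2 fun s => (hc s).continuousAt)
  have hconst := constant_of_has_deriv_right_zero (a := 0) (b := t) hcont.continuousOn
    (fun s hs => hderiv s hs.1) t ⟨t.2, le_rfl⟩
  simpa [c, hS.isC0Semigroup.map_zero] using hconst

end Semigroups

section DiagonalSemigroup

theorem norm_exp_sub_one_le_of_re_nonpos {z : ℂ} (hz : z.re ≤ 0) : ‖Complex.exp z - 1‖ ≤ ‖z‖ := by
  have h := (convex_halfSpace_re_le 0).norm_image_sub_le_of_norm_hasDerivWithin_le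
    (f := Complex.exp) (C := 1) (x := 0) (y := z)
    (fun w _ => (Complex.hasDerivAt_exp w).hasDerivWithinAt)
    (fun w hw => by rw [Complex.norm_exp]; exact Real.exp_le_one_iff.2 hw) (by simp) hz
  simpa using h

theorem norm_exp_mul_le_one {z : ℂ} (hz : z.re ≤ 0) (t : ℝ≥0) : ‖Complex.exp (t * z)‖ ≤ 1 := by
  rw [Complex.norm_exp, Real.exp_le_one_iff, Complex.re_ofReal_mul]
  exact mul_nonpos_of_nonneg_of_nonpos t.2 hz

theorem tendsto_inv_smul_exp_sub_one (z : ℂ) :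
    Tendsto (fun h : ℝ≥0 => (h : ℝ)⁻¹ • (Complex.exp (h * z) - 1)) (𝓝[>] 0) (𝓝 z) := by
  have h : HasDerivAt (fun t : ℝ => Complex.exp (t * z)) z 0 := by
    have := (HasDerivAt.cexp (hasDerivAt_mul_const (x := ((0 : ℝ) : ℂ)) z)).comp_ofReal
    simpa using this
  have h' := h.tendsto_slope_zero_right
  rw [← NNReal.coe_zero, ← NNReal.map_coe_nhdsGT, tendsto_map'_iff] at h'
  simpa [Function.comp_def] using h'

variable {ι : Type*} {p : ℝ≥0∞} [Fact (1 ≤ p)] {μ : ι → ℂ}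

/-- The contraction semigroup on `ℓ^p(ι; ℂ)` generated by multiplication by `μ`. -/
noncomputable def diagonalSemigroup (hμ : ∀ i, (μ i).re ≤ 0) (t : ℝ≥0) :
    lp (fun _ : ι => ℂ) p →L[ℝ] lp (fun _ : ι => ℂ) p :=
  multiplier (fun i => Complex.exp (t * μ i)) fun i => norm_exp_mul_le_one (hμ i) t

@[simp]
theorem diagonalSemigroup_apply (hμ : ∀ i, (μ i).re ≤ 0) (t : ℝ≥0) (f : lp (fun _ : ι => ℂ) p)
    (i : ι) : diagonalSemigroup hμ t f i = Complex.exp (t * μ i) * f i :=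
  rfl

theorem isC0Semigroup_diagonalSemigroup (hp : p ≠ ∞) (hμ : ∀ i, (μ i).re ≤ 0) :
    IsC0Semigroup (diagonalSemigroup (p := p) hμ) where
  map_zero := ContinuousLinearMap.ext fun f => lp.ext <| funext fun i => by simp
  map_add s t := ContinuousLinearMap.ext fun f => lp.ext <| funext fun i => by
    simp [add_mul, Complex.exp_add, mul_assoc]
  continuous_orbit f := continuous_iff_continuousAt.2 fun t =>
    tendsto_lp_of_dominated hp f
      (.of_forall fun s i => by
        simpa using mul_le_of_le_one_left (norm_nonneg (f i)) (norm_exp_mul_le_one (hμ i) s))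
      fun i => Continuous.tendsto (by simp only [diagonalSemigroup_apply]; fun_prop) t

theorem isSemigroupGeneratedBy_diagonalSemigroup (hp : p ≠ ∞) (hμ : ∀ i, (μ i).re ≤ 0) :
    IsSemigroupGeneratedBy (fun f g => ∀ i, g i = μ i * f i) (diagonalSemigroup (p := p) hμ) where
  isC0Semigroup := isC0Semigroup_diagonalSemigroup hp hμ
  generator_iff f g := by
    have hcoord (i : ι) (h : ℝ≥0) : ((h : ℝ)⁻¹ • (diagonalSemigroup hμ h f - f)) i =
        ((h : ℝ)⁻¹ • (Complex.exp (h * μ i) - 1)) * f i := by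
      rw [lp.coeFn_smul, lp.coeFn_sub]
      simp [sub_mul, mul_sub, mul_assoc]
    have hlim (i : ι) : Tendsto
        (fun h : ℝ≥0 => ((h : ℝ)⁻¹ • (diagonalSemigroup hμ h f - f)) i) (𝓝[>] 0)
        (𝓝 (μ i * f i)) := by
      simp_rw [hcoord]
      exact (tendsto_inv_smul_exp_sub_one (μ i)).mul_const (f i)
    refine ⟨fun hg => ?_, fun hg i => ?_⟩
    · refine tendsto_lp_of_dominated hp g ?_ fun i => hg i ▸ hlim i
      filter_upwards [self_mem_nhdsWithin] with h (hh : 0 < h) i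
      have hre : (h * μ i).re ≤ 0 := by
        rw [Complex.re_ofReal_mul]
        exact mul_nonpos_of_nonneg_of_nonpos h.2 (hμ i)
      calc ‖((h : ℝ)⁻¹ • (diagonalSemigroup hμ h f - f)) i‖
          = (h : ℝ)⁻¹ * ‖Complex.exp (h * μ i) - 1‖ * ‖f i‖ := by
            rw [hcoord, norm_mul, norm_smul, Real.norm_of_nonneg (by positivity)]
        _ ≤ (h : ℝ)⁻¹ * ‖h * μ i‖ * ‖f i‖ := by
            gcongr
            exact norm_exp_sub_one_le_of_re_nonpos hre
        _ = ‖g i‖ := by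
            rw [hg, norm_mul, norm_mul, Complex.norm_real, NNReal.norm_eq,
              inv_mul_cancel_left₀ (NNReal.coe_ne_zero.2 hh.ne')]
    · exact tendsto_nhds_unique
        (((lp.evalCLM ℝ (fun _ : ι => ℂ) p i).continuous.tendsto g).comp hg) (hlim i)

/-- In the coordinates `U`, the operator with graph `G` is multiplication by the family `μ`, on its
maximal domain. -/
def IsDiagonalOperator {X : Type*} [NormedAddCommGroup X] [NormedSpace ℝ X]
    (U : X ≃L[ℝ] lp (fun _ : ι => ℂ) p) (μ : ι → ℂ) (G : X → X → Prop) : Prop :=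
  ∀ x y, G x y ↔ ∀ i, U y i = μ i * U x i

variable {X : Type*} [NormedAddCommGroup X] [NormedSpace ℝ X] {U : X ≃L[ℝ] lp (fun _ : ι => ℂ) p}
  {G : X → X → Prop} {S : ℝ≥0 → X →L[ℝ] X}

theorem IsDiagonalOperator.semigroup_apply_single [DecidableEq ι] (hG : IsDiagonalOperator U μ G)
    (hS : IsSemigroupGeneratedBy G S) (t : ℝ≥0) (i : ι) (v : ℂ) :
    S t (U.symm (lp.single p i v)) = U.symm (lp.single p i (Complex.exp (t * μ i) * v)) := by
  refine hS.apply_complexLine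
    (J := U.symm ∘L lp.singleContinuousLinearMap ℝ (fun _ : ι => ℂ) p i) (fun w => ?_) t v
  refine (hG _ _).2 fun j => ?_
  rcases eq_or_ne j i with rfl | hj
  · simp
  · simp [hj]

theorem IsDiagonalOperator.semigroup_unique (hG : IsDiagonalOperator U μ G) (hp : p ≠ ∞)
    {R : ℝ≥0 → X →L[ℝ] X} (hR : IsSemigroupGeneratedBy G R) (hS : IsSemigroupGeneratedBy G S) :
    R = S := by
  classical
  funext t
  let V : lp (fun _ : ι => ℂ) p →L[ℝ] X := U.symm
  have h : R t ∘L V = S t ∘L V :=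
    lp.ext_continuousLinearMap hp fun i => ContinuousLinearMap.ext fun v =>
      (hG.semigroup_apply_single hR t i v).trans (hG.semigroup_apply_single hS t i v).symm
  exact ContinuousLinearMap.ext fun x => by simpa [V] using DFunLike.congr_fun h (U x)

theorem IsDiagonalOperator.exists_semigroup (hG : IsDiagonalOperator U μ G) (hp : p ≠ ∞)
    (hμ : ∀ i, (μ i).re ≤ 0) : ∃ S : ℝ≥0 → X →L[ℝ] X, IsSemigroupGeneratedBy G S := by
  have hD := isSemigroupGeneratedBy_diagonalSemigroup hp hμ
  let S (t : ℝ≥0) : X →L[ℝ] X :=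
    (U.symm : _ →L[ℝ] X) ∘L diagonalSemigroup (p := p) hμ t ∘L (U : X →L[ℝ] _)
  have hquot (x : X) (h : ℝ≥0) : U ((h : ℝ)⁻¹ • (S h x - x)) =
      (h : ℝ)⁻¹ • (diagonalSemigroup hμ h (U x) - U x) := by
    simp only [S, map_smul, map_sub, ContinuousLinearMap.comp_apply,
      ContinuousLinearEquiv.coe_coe, ContinuousLinearEquiv.apply_symm_apply]
  refine ⟨S, ⟨?_, fun s t => ?_, fun x => ?_⟩, fun x y => ?_⟩
  · exact ContinuousLinearMap.ext fun x => by simp [S, hD.isC0Semigroup.map_zero]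
  · exact ContinuousLinearMap.ext fun x => by simp [S, hD.isC0Semigroup.map_add]
  · exact U.symm.continuous.comp (hD.isC0Semigroup.continuous_orbit (U x))
  · rw [hG, hD.generator_iff, U.toHomeomorph.isInducing.tendsto_nhds_iff]
    exact tendsto_congr fun h => (hquot x h).symm

end DiagonalSemigroup

section MeanOscillation

theorem lintegral_sq_le {α : Type*} [MeasurableSpace α] {μ : Measure α} [IsProbabilityMeasure μ]
    {f : α → ℝ≥0∞} (hf : AEMeasurable f μ) : (∫⁻ x, f x ∂μ) ^ 2 ≤ ∫⁻ x, f x ^ 2 ∂μ := by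
  have holder : ∫⁻ x, f x ∂μ ≤ (∫⁻ x, f x ^ 2 ∂μ) ^ (1 / 2 : ℝ) := by
    simpa using ENNReal.lintegral_mul_le_Lp_mul_Lq μ Real.HolderConjugate.two_two hf
      (aemeasurable_const (b := 1))
  calc (∫⁻ x, f x ∂μ) ^ 2 ≤ ((∫⁻ x, f x ^ 2 ∂μ) ^ (1 / 2 : ℝ)) ^ 2 := by gcongr
    _ = ∫⁻ x, f x ^ 2 ∂μ := by rw [← ENNReal.rpow_mul_natCast]; norm_num

theorem enorm_integral_sq_le {α F : Type*} [MeasurableSpace α] {μ : Measure α}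
    [IsProbabilityMeasure μ] [NormedAddCommGroup F] [NormedSpace ℝ F] {f : α → F}
    (hf : AEStronglyMeasurable f μ) : ‖∫ x, f x ∂μ‖ₑ ^ 2 ≤ ∫⁻ x, ‖f x‖ₑ ^ 2 ∂μ :=
  (pow_le_pow_left₀ (by simp) (enorm_integral_le_lintegral_enorm f) 2).trans
    (lintegral_sq_le hf.enorm)

theorem enorm_sub_setAverage_sq_le {α F : Type*} [MeasurableSpace α] {μ : Measure α} {B : Set α}
    (hB : μ B ≠ 0) (hB' : μ B ≠ ∞) [NormedAddCommGroup F] [NormedSpace ℝ F] [CompleteSpace F]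
    {f : α → F} (hf : IntegrableOn f B μ) (v : F) :
    ‖v - ⨍ y in B, f y ∂μ‖ₑ ^ 2 ≤ ⨍⁻ y in B, ‖v - f y‖ₑ ^ 2 ∂μ := by
  have : IsFiniteMeasure (μ.restrict B) := isFiniteMeasure_restrict.2 hB'
  have : NeZero (μ.restrict B) := ⟨mt Measure.restrict_eq_zero.1 hB⟩
  have havg : v - ⨍ y in B, f y ∂μ = ⨍ y in B, (v - f y) ∂μ := by
    rw [average, average, integral_sub (integrable_const v) hf.to_average, integral_const,
      probReal_univ, one_smul]
  rw [havg]
  exact enorm_integral_sq_le ((integrable_const v).sub hf).to_average.aestronglyMeasurable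

variable {E F : Type*} [NormedAddCommGroup E] [NormedSpace ℝ E]
  [NormedAddCommGroup F] [NormedSpace ℝ F] [CompleteSpace F] {φ : E → F}

theorem enorm_sub_sq_le_lintegral_fderiv (hφ : ContDiff ℝ 1 φ) (x h : E) :
    ‖φ (x + h) - φ x‖ₑ ^ 2 ≤
      ‖h‖ₑ ^ 2 * ∫⁻ t in Set.Ioc (0 : ℝ) 1, ‖fderiv ℝ φ (x + t • h)‖ₑ ^ 2 := by
  have hprob : IsProbabilityMeasure (volume.restrict (Set.Ioc (0 : ℝ) 1)) := ⟨by simp⟩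
  have hcont : Continuous fun t : ℝ => fderiv ℝ φ (x + t • h) :=
    (hφ.continuous_fderiv one_ne_zero).comp (by fun_prop)
  have hderiv (t : ℝ) : HasDerivAt (fun t : ℝ => φ (x + t • h)) (fderiv ℝ φ (x + t • h) h) t := by
    have hline : HasDerivAt (fun t : ℝ => x + t • h) h t := by
      simpa using ((hasDerivAt_id t).smul_const h).const_add x
    exact (hφ.differentiable one_ne_zero _).hasFDerivAt.comp_hasDerivAt t hline
  have hcont' : Continuous fun t : ℝ => fderiv ℝ φ (x + t • h) h := hcont.clm_apply continuous_const
  have hftc : φ (x + h) - φ x = ∫ t in Set.Ioc (0 : ℝ) 1, fderiv ℝ φ (x + t • h) h := by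
    rw [← intervalIntegral.integral_of_le zero_le_one,
      intervalIntegral.integral_eq_sub_of_hasDerivAt (fun t _ => hderiv t)
        (hcont'.intervalIntegrable 0 1), one_smul, zero_smul, add_zero]
  calc ‖φ (x + h) - φ x‖ₑ ^ 2
      ≤ ∫⁻ t in Set.Ioc (0 : ℝ) 1, ‖fderiv ℝ φ (x + t • h) h‖ₑ ^ 2 :=
        hftc ▸ enorm_integral_sq_le hcont'.aestronglyMeasurable
    _ ≤ ∫⁻ t in Set.Ioc (0 : ℝ) 1, ‖h‖ₑ ^ 2 * ‖fderiv ℝ φ (x + t • h)‖ₑ ^ 2 := by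
        gcongr with t
        rw [← mul_pow, mul_comm]
        gcongr
        exact ContinuousLinearMap.le_opENorm _ _
    _ = ‖h‖ₑ ^ 2 * ∫⁻ t in Set.Ioc (0 : ℝ) 1, ‖fderiv ℝ φ (x + t • h)‖ₑ ^ 2 :=
        lintegral_const_mul' _ _ (by simp)

variable [FiniteDimensional ℝ E] [MeasurableSpace E] [BorelSpace E] (μ : Measure E)
  [μ.IsAddHaarMeasure]

theorem lintegral_translate_sub_sq_le (hφ : ContDiff ℝ 1 φ) (h : E) :
    ∫⁻ x, ‖φ (x + h) - φ x‖ₑ ^ 2 ∂μ ≤ ‖h‖ₑ ^ 2 * ∫⁻ x, ‖fderiv ℝ φ x‖ₑ ^ 2 ∂μ := by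
  have hcont : Continuous fun p : E × ℝ => ‖fderiv ℝ φ (p.1 + p.2 • h)‖ₑ ^ 2 :=
    (ENNReal.continuous_pow 2).comp
      ((hφ.continuous_fderiv one_ne_zero).comp (by fun_prop)).enorm
  calc ∫⁻ x, ‖φ (x + h) - φ x‖ₑ ^ 2 ∂μ
      ≤ ∫⁻ x, ‖h‖ₑ ^ 2 * (∫⁻ t in Set.Ioc (0 : ℝ) 1, ‖fderiv ℝ φ (x + t • h)‖ₑ ^ 2) ∂μ :=
        lintegral_mono fun x => enorm_sub_sq_le_lintegral_fderiv hφ x h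
    _ = ‖h‖ₑ ^ 2 * ∫⁻ t in Set.Ioc (0 : ℝ) 1, ∫⁻ x, ‖fderiv ℝ φ (x + t • h)‖ₑ ^ 2 ∂μ := by
        rw [lintegral_const_mul' _ _ (by simp), lintegral_lintegral_swap hcont.aemeasurable]
    _ = ‖h‖ₑ ^ 2 * ∫⁻ _ in Set.Ioc (0 : ℝ) 1, ∫⁻ x, ‖fderiv ℝ φ x‖ₑ ^ 2 ∂μ := by
        simp only [lintegral_add_right_eq_self fun x => ‖fderiv ℝ φ x‖ₑ ^ 2]
    _ = ‖h‖ₑ ^ 2 * ∫⁻ x, ‖fderiv ℝ φ x‖ₑ ^ 2 ∂μ := by simp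

theorem enorm_sub_ballAverage_sq_le (hφ : Continuous φ) {ε : ℝ} (hε : 0 < ε) {x c : E}
    (hxc : dist x c ≤ ε) :
    ‖φ x - ⨍ y in Metric.ball c ε, φ y ∂μ‖ₑ ^ 2 ≤
      (μ (Metric.ball 0 ε))⁻¹ * ∫⁻ h in Metric.ball 0 (2 * ε), ‖φ (x + h) - φ x‖ₑ ^ 2 ∂μ := by
  have hint : IntegrableOn φ (Metric.ball c ε) μ :=
    (hφ.locallyIntegrable.integrableOn_isCompact (isCompact_closedBall c ε)).mono_set
      Metric.ball_subset_closedBall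
  have hsub : (x + ·) ⁻¹' Metric.ball c ε ⊆ Metric.ball 0 (2 * ε) := by
    intro h (hh : dist (x + h) c < ε)
    rw [mem_ball_zero_iff]
    linarith [dist_triangle_right (x + h) x c, dist_self_add_left h x]
  calc ‖φ x - ⨍ y in Metric.ball c ε, φ y ∂μ‖ₑ ^ 2
      ≤ ⨍⁻ y in Metric.ball c ε, ‖φ x - φ y‖ₑ ^ 2 ∂μ :=
        enorm_sub_setAverage_sq_le (Metric.measure_ball_pos μ c hε).ne' measure_ball_lt_top.ne
          hint (φ x)
    _ = (μ (Metric.ball 0 ε))⁻¹ * ∫⁻ y in Metric.ball c ε, ‖φ y - φ x‖ₑ ^ 2 ∂μ := by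
        simp only [setLAverage_eq, ENNReal.div_eq_inv_mul, Measure.addHaar_ball_center μ c,
          enorm_sub_rev]
    _ = (μ (Metric.ball 0 ε))⁻¹ *
          ∫⁻ h in (x + ·) ⁻¹' Metric.ball c ε, ‖φ (x + h) - φ x‖ₑ ^ 2 ∂μ := by
        rw [(measurePreserving_add_left μ x).setLIntegral_comp_preimage_emb
          (measurableEmbedding_addLeft x) fun y => ‖φ y - φ x‖ₑ ^ 2]
    _ ≤ _ := by gcongr

/-- A Poincaré inequality, with respect to averages over balls of radius `ε` centred within `ε`. -/
theorem lintegral_sub_ballAverage_sq_le (hφ : ContDiff ℝ 1 φ) {ε : ℝ} (hε : 0 < ε)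
    {s : E → E} {A : Set E} (hA : MeasurableSet A) (hs : ∀ x ∈ A, dist x (s x) ≤ ε) :
    ∫⁻ x in A, ‖φ x - ⨍ y in Metric.ball (s x) ε, φ y ∂μ‖ₑ ^ 2 ∂μ ≤
      ENNReal.ofReal (2 ^ Module.finrank ℝ E * (2 * ε) ^ 2) * ∫⁻ x, ‖fderiv ℝ φ x‖ₑ ^ 2 ∂μ := by
  set V := μ (Metric.ball 0 ε)
  have hV : V ≠ 0 := (Metric.measure_ball_pos μ 0 hε).ne'
  have hdouble : V⁻¹ * μ (Metric.ball 0 (2 * ε)) = ENNReal.ofReal (2 ^ Module.finrank ℝ E) := by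
    rw [Measure.addHaar_ball_mul_of_pos μ 0 two_pos, mul_comm, mul_assoc,
      ENNReal.mul_inv_cancel hV measure_ball_lt_top.ne, mul_one]
  have hcont : Continuous fun p : E × E => ‖φ (p.1 + p.2) - φ p.1‖ₑ ^ 2 := by
    have := hφ.continuous
    exact (ENNReal.continuous_pow 2).comp (by fun_prop : Continuous fun p : E × E =>
      φ (p.1 + p.2) - φ p.1).enorm
  calc ∫⁻ x in A, ‖φ x - ⨍ y in Metric.ball (s x) ε, φ y ∂μ‖ₑ ^ 2 ∂μ
      ≤ ∫⁻ x in A, V⁻¹ * ∫⁻ h in Metric.ball 0 (2 * ε), ‖φ (x + h) - φ x‖ₑ ^ 2 ∂μ ∂μ :=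
        setLIntegral_mono' hA fun x hx =>
          enorm_sub_ballAverage_sq_le μ hφ.continuous hε (hs x hx)
    _ ≤ ∫⁻ x, V⁻¹ * ∫⁻ h in Metric.ball 0 (2 * ε), ‖φ (x + h) - φ x‖ₑ ^ 2 ∂μ ∂μ :=
        setLIntegral_le_lintegral _ _
    _ = V⁻¹ * ∫⁻ h in Metric.ball 0 (2 * ε), ∫⁻ x, ‖φ (x + h) - φ x‖ₑ ^ 2 ∂μ ∂μ := by
        rw [lintegral_const_mul' _ _ (ENNReal.inv_ne_top.2 hV),
          lintegral_lintegral_swap hcont.aemeasurable]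
    _ ≤ V⁻¹ * ∫⁻ _ in Metric.ball 0 (2 * ε),
          (ENNReal.ofReal ((2 * ε) ^ 2) * ∫⁻ x, ‖fderiv ℝ φ x‖ₑ ^ 2 ∂μ) ∂μ := by
        refine mul_le_mul_right (setLIntegral_mono' Metric.isOpen_ball.measurableSet
          fun h hh => (lintegral_translate_sub_sq_le μ hφ h).trans ?_) _
        rw [← ofReal_norm, ← ENNReal.ofReal_pow (norm_nonneg _)]
        gcongr
        exact (mem_ball_zero_iff.1 hh).le
    _ = _ := by
        rw [setLIntegral_const, mul_comm _ (μ _), ← mul_assoc, hdouble, ← mul_assoc,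
          ← ENNReal.ofReal_mul (by positivity)]

end MeanOscillation

theorem exists_simpleFunc_dist_lt {E : Type*} [PseudoMetricSpace E] [Nonempty E]
    [MeasurableSpace E] [OpensMeasurableSpace E] {A : Set E} (hA : TotallyBounded A) {ε : ℝ}
    (hε : 0 < ε) : ∃ s : SimpleFunc E E, ∀ x ∈ A, dist x (s x) < ε := by
  obtain ⟨t, ht, hcover⟩ := Metric.totallyBounded_iff.1 hA ε hε
  obtain ⟨n, y, -, rfl⟩ := ht.fin_param
  obtain ⟨y', hy'⟩ : ∃ y' : ℕ → E, ∀ k : Fin n, y' k = y k :=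
    ⟨Function.extend Fin.val y fun _ => Classical.arbitrary E, Fin.val_injective.extend_apply y _⟩
  refine ⟨SimpleFunc.nearestPt y' n, fun x hx => ?_⟩
  obtain ⟨k, hk⟩ : ∃ k, dist x (y k) < ε := by simpa using hcover hx
  have hnearest := SimpleFunc.edist_nearestPt_le y' x k.is_lt.le
  rw [hy', edist_comm, edist_comm (y k), edist_dist, edist_dist,
    ENNReal.ofReal_le_ofReal_iff dist_nonneg] at hnearest
  exact hnearest.trans_lt hk

section FormMethod

universe u

variable {X : Type u} {Y : Type*} [NormedAddCommGroup X] [InnerProductSpace ℝ X]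
  [NormedAddCommGroup Y] [InnerProductSpace ℝ Y]

/-- A generator `A` is encoded by its resolvent `R = (1 - A)⁻¹`: `A u = f` iff `u = R (u - f)`. -/
theorem exists_eigenbasis_of_resolvent [CompleteSpace X] {R : X →L[ℝ] X} (hK : IsCompactOperator R)
    (hpos : R.IsPositive) (hle : ‖R‖ ≤ 1) (hinj : Function.Injective R) :
    ∃ (ι : Type u) (e : HilbertBasis ι ℝ X) (lam : ι → ℝ), (∀ i, 0 ≤ lam i) ∧
      (∀ u f, u = R (u - f) ↔ ∀ i, inner ℝ (e i) f = -lam i * inner ℝ (e i) u) ∧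
      (¬ FiniteDimensional ℝ X → ∀ C, ∃ i, C < lam i) := by
  obtain ⟨ι, e, μ, hμ⟩ := exists_hilbertBasis_eigenvectors hK hpos.isSymmetric
  have hμ_pos (i : ι) : 0 < μ i := by
    have hnonneg : 0 ≤ μ i := by
      simpa [hμ, real_inner_smul_left, e.orthonormal.1] using hpos.inner_nonneg_left (e i)
    refine hnonneg.lt_of_ne fun h0 => e.orthonormal.ne_zero i (hinj ?_)
    rw [hμ, ← h0, zero_smul, map_zero]
  have hμ_le (i : ι) : μ i ≤ 1 := by
    have hnorm := R.le_of_opNorm_le hle (e i)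
    rw [hμ, norm_smul, e.orthonormal.1, mul_one, mul_one] at hnorm
    exact (le_abs_self _).trans hnorm
  have hcoord (x : X) (i : ι) : inner ℝ (e i) (R x) = μ i * inner ℝ (e i) x := by
    rw [← hpos.isSymmetric.apply_clm, hμ, real_inner_smul_left]
  refine ⟨ι, e, fun i => (μ i)⁻¹ - 1, fun i => sub_nonneg.2 ((one_le_inv₀ (hμ_pos i)).2 (hμ_le i)),
    fun u f => ?_, fun hinf C => ?_⟩
  · have hi (i : ι) : inner ℝ (e i) u = inner ℝ (e i) (R (u - f)) ↔
        inner ℝ (e i) f = -((μ i)⁻¹ - 1) * inner ℝ (e i) u := by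
      rw [hcoord, inner_sub_right]
      have := (hμ_pos i).ne'
      field_simp
      constructor <;> intro h <;> linarith
    exact ⟨fun h i => (hi i).1 (congrArg _ h),
      fun h => ext_inner_hilbertBasis e fun i => (hi i).2 (h i)⟩
  · obtain ⟨i, hi⟩ := exists_norm_eigenvalue_lt hK hinf e hcoord (δ := (|C| + 2)⁻¹) (by positivity)
    have hlt := (lt_inv_comm₀ (hμ_pos i) (by positivity)).1 ((le_abs_self _).trans_lt hi)
    exact ⟨i, lt_sub_iff_add_lt.2 (by linarith [le_abs_self C])⟩

theorem inner_prod (v w : WithLp 2 (X × Y)) :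
    inner ℝ v w = inner ℝ v.fst w.fst + inner ℝ v.snd w.snd :=
  WithLp.prod_inner_apply v w

variable (W : Submodule ℝ (WithLp 2 (X × Y)))

/-- The graph of the operator `-D*D`, where `W` is the graph of a closed operator `D` from `X` to
`Y`: `-D*D u = f` in the weak sense. For `D` the gradient with domain `H¹₀` this is the Dirichlet
Laplacian. -/
def IsFormOperator (u f : X) : Prop :=
  ∃ g : Y, WithLp.toLp 2 (u, g) ∈ W ∧ ∀ v ∈ W, inner ℝ g v.snd = -inner ℝ f v.fst

variable {W} in
theorem forall_mem_topologicalClosure_inner_iff {f : X} {g : Y} :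
    (∀ v ∈ W.topologicalClosure, inner ℝ g v.snd = -inner ℝ f v.fst) ↔
      ∀ v ∈ W, inner ℝ g v.snd = -inner ℝ f v.fst :=
  ⟨fun h v hv => h v (W.le_topologicalClosure hv), fun h _ hv => closure_minimal h
    (isClosed_eq (continuous_const.inner (WithLp.continuous_snd 2 X Y))
      (continuous_const.inner (WithLp.continuous_fst 2 X Y)).neg) hv⟩

/-- The embedding into `X` of the domain of a closed operator from `X` to `Y` with graph `W`; the
domain carries the graph norm. -/
noncomputable def formEmbedding : W →L[ℝ] X :=
  WithLp.fstL 2 ℝ X Y ∘L W.subtypeL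

theorem formEmbedding_apply (v : W) : formEmbedding W v = v.1.fst := rfl

theorem norm_formEmbedding_le : ‖formEmbedding W‖ ≤ 1 :=
  ContinuousLinearMap.opNorm_le_bound _ zero_le_one fun v => by
    rw [one_mul]
    exact WithLp.norm_fst_le _ v.1

variable {W} in
theorem norm_comp_formEmbedding_topologicalClosure_le {Z : Type*} [NormedAddCommGroup Z]
    [NormedSpace ℝ Z] (A : X →L[ℝ] Z) {C : ℝ} (hC : 0 ≤ C)
    (h : ∀ v ∈ W, ‖A v.fst‖ ≤ C * ‖v.snd‖) : ‖A ∘L formEmbedding W.topologicalClosure‖ ≤ C := by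
  refine ContinuousLinearMap.opNorm_le_bound _ hC fun v => ?_
  have hv : ‖A v.1.fst‖ ≤ C * ‖v.1.snd‖ := closure_minimal h
    (isClosed_le (A.continuous.comp (WithLp.continuous_fst 2 X Y)).norm
      (continuous_const.mul (WithLp.continuous_snd 2 X Y).norm)) v.2
  exact hv.trans (mul_le_mul_of_nonneg_left (WithLp.norm_snd_le _ v.1) hC)

variable [CompleteSpace X] [CompleteSpace W]

/-- The resolvent `(1 + D*D)⁻¹` of the operator `-D*D` of `IsFormOperator`. -/
noncomputable def formResolvent : X →L[ℝ] X :=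
  formEmbedding W ∘L (formEmbedding W).adjoint

theorem norm_formResolvent_le : ‖formResolvent W‖ ≤ 1 := by
  have hnorm := (formEmbedding W).adjoint.norm_adjoint_comp_self
  rw [ContinuousLinearMap.adjoint_adjoint, LinearIsometryEquiv.norm_map] at hnorm
  exact hnorm.trans_le (mul_le_one₀ (norm_formEmbedding_le W)
    (norm_nonneg (formEmbedding W)) (norm_formEmbedding_le W))

theorem formResolvent_injective (hW : DenseRange (formEmbedding W)) :
    Function.Injective (formResolvent W) := by
  refine (ContinuousLinearMap.self_comp_adjoint_injective_iff (formEmbedding W)).2 ?_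
  refine (injective_iff_map_eq_zero _).2 fun h hh => ?_
  refine hW.eq_zero_of_inner_left ℝ fun v => ?_
  rw [← ContinuousLinearMap.adjoint_inner_left, hh, inner_zero_left]

variable {W} in
theorem isFormOperator_iff {u f : X} : IsFormOperator W u f ↔ u = formResolvent W (u - f) := by
  have hadj (v : W) : inner ℝ ((formEmbedding W).adjoint (u - f)) v =
      inner ℝ u v.1.fst - inner ℝ f v.1.fst := by
    rw [ContinuousLinearMap.adjoint_inner_left, formEmbedding_apply, inner_sub_left]
  constructor
  · rintro ⟨g, hg, hw⟩
    have hriesz : (⟨_, hg⟩ : W) = (formEmbedding W).adjoint (u - f) :=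
      ext_inner_right ℝ fun v => by
        rw [hadj, Submodule.coe_inner, inner_prod, WithLp.toLp_fst, WithLp.toLp_snd, hw v v.2,
          sub_eq_add_neg]
    exact congrArg (formEmbedding W) hriesz
  · intro h
    set q := (formEmbedding W).adjoint (u - f)
    have hu : u = q.1.fst := h
    refine ⟨q.1.snd, ?_, fun v hv => ?_⟩
    · rw [hu]
      exact q.2
    · have hq := hadj ⟨v, hv⟩
      rw [Submodule.coe_inner, inner_prod, ← hu, sub_eq_add_neg] at hq
      exact add_left_cancel hq

variable {W} in
theorem exists_eigenbasis_of_isFormOperator (hK : IsCompactOperator (formEmbedding W))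
    (hW : DenseRange (formEmbedding W)) :
    ∃ (ι : Type u) (e : HilbertBasis ι ℝ X) (lam : ι → ℝ), (∀ i, 0 ≤ lam i) ∧
      (∀ u f, IsFormOperator W u f ↔ ∀ i, inner ℝ (e i) f = -lam i * inner ℝ (e i) u) ∧
      (¬ FiniteDimensional ℝ X → ∀ C, ∃ i, C < lam i) := by
  simp only [isFormOperator_iff]
  exact exists_eigenbasis_of_resolvent (R := formResolvent W) (hK.comp_clm _)
    (ContinuousLinearMap.isPositive_self_comp_adjoint _) (norm_formResolvent_le W)
    (formResolvent_injective W hW)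

end FormMethod

section Gradient

variable {F : Type*} [NormedAddCommGroup F] [InnerProductSpace ℝ F] [CompleteSpace F]
  {f g : F → ℝ} {x : F}

theorem enorm_gradient (f : F → ℝ) (x : F) : ‖gradient f x‖ₑ = ‖fderiv ℝ f x‖ₑ :=
  (InnerProductSpace.toDual ℝ F).symm.enorm_map _

theorem gradient_add (hf : DifferentiableAt ℝ f x) (hg : DifferentiableAt ℝ g x) :
    gradient (f + g) x = gradient f x + gradient g x := by
  rw [gradient, fderiv_add hf hg, map_add, gradient, gradient]

theorem gradient_const_smul (c : ℝ) (hf : DifferentiableAt ℝ f x) :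
    gradient (c • f) x = c • gradient f x := by
  rw [gradient, fderiv_const_smul hf, map_smulₛₗ, gradient, conj_trivial]

end Gradient

section DirichletForm

variable {d : ℕ} {Ω : TopologicalSpace.Opens (EuclideanSpace ℝ (Fin d))}

theorem differentiable_test (φ : 𝓓(Ω, ℝ)) : Differentiable ℝ φ :=
  φ.contDiff.differentiable (by simp)

theorem continuous_gradient (φ : 𝓓(Ω, ℝ)) : Continuous (gradient φ) :=
  (InnerProductSpace.toDual ℝ (EuclideanSpace ℝ (Fin d))).symm.continuous.comp
    (φ.contDiff.continuous_fderiv (by simp))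

theorem hasCompactSupport_gradient (φ : 𝓓(Ω, ℝ)) : HasCompactSupport (gradient φ) :=
  (φ.hasCompactSupport.fderiv (𝕜 := ℝ)).comp_left (map_zero _)

theorem memLp_test (φ : 𝓓(Ω, ℝ)) :
    MemLp φ 2 (volume.restrict (Ω : Set (EuclideanSpace ℝ (Fin d)))) :=
  (φ.continuous.memLp_of_hasCompactSupport φ.hasCompactSupport).restrict _

theorem memLp_gradient (φ : 𝓓(Ω, ℝ)) :
    MemLp (gradient φ) 2 (volume.restrict (Ω : Set (EuclideanSpace ℝ (Fin d)))) :=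
  ((continuous_gradient φ).memLp_of_hasCompactSupport (hasCompactSupport_gradient φ)).restrict _

/-- The class in `L²(Ω)` of a test function. -/
noncomputable def testL2 : 𝓓(Ω, ℝ) →ₗ[ℝ] L2 Ω where
  toFun φ := (memLp_test φ).toLp φ
  map_add' φ ψ := MemLp.toLp_add (memLp_test φ) (memLp_test ψ)
  map_smul' c φ := MemLp.toLp_const_smul c (memLp_test φ)

/-- The class in `L²(Ω; ℝ^d)` of the gradient of a test function. -/
noncomputable def testGradient : 𝓓(Ω, ℝ) →ₗ[ℝ] L2Field Ω where
  toFun φ := (memLp_gradient φ).toLp (gradient φ)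
  map_add' φ ψ := by
    rw [← MemLp.toLp_add (memLp_gradient φ) (memLp_gradient ψ)]
    exact MemLp.toLp_congr _ _ (.of_forall fun x =>
      gradient_add (differentiable_test φ x) (differentiable_test ψ x))
  map_smul' c φ := by
    rw [RingHom.id_apply, ← MemLp.toLp_const_smul c (memLp_gradient φ)]
    exact MemLp.toLp_congr _ _ (.of_forall fun x =>
      gradient_const_smul c (differentiable_test φ x))

theorem coeFn_testL2 (φ : 𝓓(Ω, ℝ)) :
    testL2 φ =ᵐ[volume.restrict (Ω : Set (EuclideanSpace ℝ (Fin d)))] φ :=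
  (memLp_test φ).coeFn_toLp

theorem coeFn_testGradient (φ : 𝓓(Ω, ℝ)) :
    testGradient φ =ᵐ[volume.restrict (Ω : Set (EuclideanSpace ℝ (Fin d)))] gradient φ :=
  (memLp_gradient φ).coeFn_toLp

theorem inner_testL2 (f : L2 Ω) (φ : 𝓓(Ω, ℝ)) :
    inner ℝ f (testL2 φ) = ∫ x in (Ω : Set (EuclideanSpace ℝ (Fin d))), f x * φ x := by
  rw [L2.inner_def]
  refine integral_congr_ae ?_
  filter_upwards [coeFn_testL2 φ] with x hx
  rw [hx, RCLike.inner_apply, conj_trivial, mul_comm]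

theorem inner_testGradient (g : L2Field Ω) (φ : 𝓓(Ω, ℝ)) :
    inner ℝ g (testGradient φ) =
      ∫ x in (Ω : Set (EuclideanSpace ℝ (Fin d))), inner ℝ (g x) (gradient φ x) := by
  rw [L2.inner_def]
  refine integral_congr_ae ?_
  filter_upwards [coeFn_testGradient φ] with x hx
  rw [hx]

/-- A test function together with its gradient, as an element of `L²(Ω) × L²(Ω; ℝ^d)` with the
Hilbert norm. -/
noncomputable def testPair : 𝓓(Ω, ℝ) →ₗ[ℝ] WithLp 2 (L2 Ω × L2Field Ω) :=
  (WithLp.linearEquiv 2 ℝ (L2 Ω × L2Field Ω)).symm.toLinearMap ∘ₗ testL2.prod testGradient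

theorem coe_range_testPair :
    (LinearMap.range (testPair (Ω := Ω)) : Set (WithLp 2 (L2 Ω × L2Field Ω))) =
      WithLp.ofLp ⁻¹' testGraph Ω := by
  refine Set.ext fun v => exists_congr fun φ => ⟨?_, fun ⟨hfst, hsnd⟩ => ?_⟩
  · rintro rfl
    exact ⟨coeFn_testL2 φ, coeFn_testGradient φ⟩
  · exact WithLp.ofLp_injective 2 (Prod.ext (Lp.ext ((coeFn_testL2 φ).trans hfst.symm))
      (Lp.ext ((coeFn_testGradient φ).trans hsnd.symm)))

/-- The Hilbert space `H¹₀(Ω)`, as the space of pairs `(u, ∇u)`. -/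
noncomputable abbrev H10 (Ω : TopologicalSpace.Opens (EuclideanSpace ℝ (Fin d))) :
    Submodule ℝ (WithLp 2 (L2 Ω × L2Field Ω)) :=
  (LinearMap.range testPair).topologicalClosure

theorem toLp_mem_H10_iff {u : L2 Ω} {g : L2Field Ω} :
    WithLp.toLp 2 (u, g) ∈ H10 Ω ↔ IsH10WithGradient Ω u g := by
  rw [← SetLike.mem_coe, Submodule.topologicalClosure_coe, coe_range_testPair]
  exact (Set.ext_iff.1 ((WithLp.homeomorphProd 2 (L2 Ω) (L2Field Ω)).preimage_closure
    (testGraph Ω)) (WithLp.toLp 2 (u, g))).symm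

theorem hasDirichletLaplacian_iff_isFormOperator {u f : L2 Ω} :
    HasDirichletLaplacian Ω u f ↔ IsFormOperator (H10 Ω) u f := by
  refine exists_congr fun g => and_congr toLp_mem_H10_iff.symm ?_
  rw [forall_mem_topologicalClosure_inner_iff]
  simp only [LinearMap.mem_range, forall_exists_index, forall_apply_eq_imp_iff, ← inner_testL2,
    ← inner_testGradient]
  rfl

theorem eq_zero_of_inner_testL2 {h : L2 Ω} (hh : ∀ φ : 𝓓(Ω, ℝ), inner ℝ h (testL2 φ) = 0) :
    h = 0 := by
  have hloc : LocallyIntegrableOn h (Ω : Set (EuclideanSpace ℝ (Fin d))) volume := by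
    refine (locallyIntegrableOn_iff Ω.isOpen.isLocallyClosed).2 fun k hk hkc => ?_
    have hmem : MemLp h 2 (volume.restrict k) :=
      (Lp.memLp h).mono_measure (Measure.restrict_mono hk le_rfl)
    have : IsFiniteMeasure (volume.restrict k) := isFiniteMeasure_restrict.2 hkc.measure_ne_top
    exact hmem.integrable one_le_two
  have hae := Ω.isOpen.ae_eq_zero_of_integral_contDiff_smul_eq_zero hloc fun φ hφ hc hsupp => by
    have hint := hh ⟨φ, by simpa using hφ, hc, hsupp⟩
    rw [inner_testL2] at hint
    rw [← setIntegral_eq_integral_of_forall_compl_eq_zero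
      (s := (Ω : Set (EuclideanSpace ℝ (Fin d)))), ← hint]
    · simp only [smul_eq_mul, mul_comm (φ _)]
      rfl
    · intro x hx
      rw [image_eq_zero_of_notMem_tsupport (mt (@hsupp x) hx), zero_smul]
  have hzero : h =ᵐ[volume.restrict (Ω : Set (EuclideanSpace ℝ (Fin d)))] 0 :=
    (ae_restrict_iff' Ω.isOpen.measurableSet).2 hae
  exact Lp.ext (hzero.trans (Lp.coeFn_zero _ _ _).symm)

theorem denseRange_formEmbedding_H10 : DenseRange (formEmbedding (H10 Ω)) := by
  change Dense ((formEmbedding (H10 Ω)).range : Set (L2 Ω))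
  rw [Submodule.dense_iff_topologicalClosure_eq_top, Submodule.topologicalClosure_eq_top_iff,
    Submodule.eq_bot_iff]
  refine fun h hh => eq_zero_of_inner_testL2 fun φ => (Submodule.mem_orthogonal' _ _).1 hh _ ?_
  exact ⟨⟨testPair φ, Submodule.le_topologicalClosure _ (LinearMap.mem_range_self _ φ)⟩, rfl⟩

end DirichletForm

section FiniteRank

theorem isCompactOperator_of_forall_exists_norm_sub_le {X Y : Type*} [NormedAddCommGroup X]
    [NormedSpace ℝ X] [NormedAddCommGroup Y] [NormedSpace ℝ Y] [CompleteSpace Y] {f : X →L[ℝ] Y}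
    (h : ∀ ε > 0, ∃ g : X →L[ℝ] Y, IsCompactOperator g ∧ ‖f - g‖ ≤ ε) : IsCompactOperator f := by
  refine isClosed_setOfPred_isCompactOperator.closure_subset
    (Metric.mem_closure_iff.2 fun ε hε => ?_)
  obtain ⟨g, hg, hfg⟩ := h (ε / 2) (half_pos hε)
  exact ⟨g, hg, (dist_eq_norm f g).trans_lt (hfg.trans_lt (half_lt_self hε))⟩

variable {X α β : Type*} [NormedAddCommGroup X] [NormedSpace ℝ X] [MeasurableSpace α]

/-- The finite rank operator `u ↦ (x ↦ ℓ (s x) u)` from `X` to `L²(μ)`. -/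
noncomputable def finiteRankL2 (μ : Measure α) [IsFiniteMeasure μ] (s : SimpleFunc α β)
    (ℓ : β → X →L[ℝ] ℝ) : X →L[ℝ] Lp ℝ 2 μ :=
  ∑ c ∈ s.range, (ℓ c).smulRight
    (indicatorConstLp 2 (s.measurableSet_fiber c) (measure_ne_top μ _) (1 : ℝ))

variable {μ : Measure α} [IsFiniteMeasure μ] (s : SimpleFunc α β) (ℓ : β → X →L[ℝ] ℝ)

theorem isCompactOperator_finiteRankL2 : IsCompactOperator (finiteRankL2 μ s ℓ) :=
  Submodule.sum_mem (compactOperator (RingHom.id ℝ) X (Lp ℝ 2 μ)) fun c _ =>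
    (isCompactOperator_of_locallyCompactSpace_dom (ℓ c)).clm_comp
      (ContinuousLinearMap.toSpanSingleton ℝ _)

theorem coeFn_finiteRankL2 (u : X) : finiteRankL2 μ s ℓ u =ᵐ[μ] fun x => ℓ (s x) u := by
  have hterm (c : β) : (ℓ c u • indicatorConstLp 2 (s.measurableSet_fiber c) (measure_ne_top μ _)
      (1 : ℝ) : Lp ℝ 2 μ) =ᵐ[μ] fun x => ℓ c u * (s ⁻¹' {c}).indicator (fun _ => (1 : ℝ)) x := by
    filter_upwards [Lp.coeFn_smul (ℓ c u) (indicatorConstLp 2 (s.measurableSet_fiber c)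
      (measure_ne_top μ _) (1 : ℝ)), indicatorConstLp_coeFn (p := 2) (μ := μ)
        (hs := s.measurableSet_fiber c) (hμs := measure_ne_top μ _) (c := (1 : ℝ))]
      with x hsmul hind
    rw [hsmul, Pi.smul_apply, hind, smul_eq_mul]
  rw [finiteRankL2, _root_.sum_apply]
  simp only [ContinuousLinearMap.smulRight_apply]
  refine (Lp.coeFn_finsetSum _ _).trans ?_
  filter_upwards [(eventually_all_finset s.range).2 fun c _ => hterm c] with x hx
  rw [Finset.sum_apply, Finset.sum_congr rfl hx, Finset.sum_eq_single (s x)]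
  · simp
  · intro c _ hc
    rw [Set.indicator_of_notMem (by simpa using hc.symm), mul_zero]
  · exact fun h => absurd (s.mem_range_self x) h

end FiniteRank

section Rellich

theorem enorm_sq_eq_lintegral {α E : Type*} [MeasurableSpace α] {μ : Measure α}
    [NormedAddCommGroup E] (f : Lp E 2 μ) : ‖f‖ₑ ^ 2 = ∫⁻ x, ‖f x‖ₑ ^ 2 ∂μ := by
  simpa [Lp.enorm_def] using eLpNorm_nnreal_pow_eq_lintegral (f := f) (μ := μ) two_ne_zero

variable {d : ℕ} {Ω : TopologicalSpace.Opens (EuclideanSpace ℝ (Fin d))}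

/-- The functional on `L²(Ω)` averaging a function, extended by zero outside `Ω`, over the ball of
radius `ε` around `c`. -/
noncomputable def ballAverage (Ω : TopologicalSpace.Opens (EuclideanSpace ℝ (Fin d))) (ε : ℝ)
    (c : EuclideanSpace ℝ (Fin d)) : L2 Ω →L[ℝ] ℝ :=
  (volume.real (Metric.ball c ε))⁻¹ • innerSL ℝ (indicatorConstLp 2 measurableSet_ball
    ((Measure.restrict_apply_le _ _).trans_lt (measure_ball_lt_top (x := c) (r := ε))).ne (1 : ℝ))

theorem ballAverage_testL2 (ε : ℝ) (c : EuclideanSpace ℝ (Fin d)) (φ : 𝓓(Ω, ℝ)) :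
    ballAverage Ω ε c (testL2 φ) = ⨍ y in Metric.ball c ε, φ y := by
  have hae : ∀ᵐ x ∂volume.restrict (Metric.ball c ε ∩ Ω), testL2 φ x = φ x :=
    ae_restrict_of_ae_restrict_of_subset Set.inter_subset_right (coeFn_testL2 φ)
  rw [ballAverage, _root_.smul_apply, innerSL_apply_apply, L2.inner_indicatorConstLp_one,
    Measure.restrict_restrict measurableSet_ball, integral_congr_ae hae, setAverage_eq,
    setIntegral_eq_of_subset_of_forall_sdiff_eq_zero measurableSet_ball Set.inter_subset_left]
  exact fun x hx => image_eq_zero_of_notMem_tsupport fun hx' =>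
    hx.2 ⟨hx.1, φ.tsupport_subset hx'⟩

theorem enorm_testGradient_sq (φ : 𝓓(Ω, ℝ)) :
    ‖testGradient φ‖ₑ ^ 2 = ∫⁻ x, ‖fderiv ℝ φ x‖ₑ ^ 2 := by
  rw [enorm_sq_eq_lintegral]
  refine (lintegral_congr_ae ?_).trans
    (setLIntegral_eq_of_support_subset (f := fun x => ‖fderiv ℝ φ x‖ₑ ^ 2) fun x hx => ?_)
  · filter_upwards [coeFn_testGradient φ] with x hx
    rw [hx, enorm_gradient]
  · refine φ.tsupport_subset (by_contra fun hx' => hx ?_)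
    change ‖fderiv ℝ φ x‖ₑ ^ 2 = 0
    rw [← enorm_gradient, gradient, fderiv_of_notMem_tsupport ℝ hx', map_zero, enorm_zero,
      zero_pow two_ne_zero]

theorem norm_testL2_sub_finiteRankL2_le
    [IsFiniteMeasure (volume.restrict (Ω : Set (EuclideanSpace ℝ (Fin d))))] {ε : ℝ} (hε : 0 < ε)
    {s : SimpleFunc (EuclideanSpace ℝ (Fin d)) (EuclideanSpace ℝ (Fin d))}
    (hs : ∀ x ∈ Ω, dist x (s x) ≤ ε) (φ : 𝓓(Ω, ℝ)) :
    ‖testL2 φ - finiteRankL2 _ s (ballAverage Ω ε) (testL2 φ)‖ ≤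
      √(2 ^ d) * (2 * ε) * ‖testGradient φ‖ := by
  refine (sq_le_sq₀ (norm_nonneg _) (by positivity)).1 ?_
  rw [mul_pow, mul_pow (√_), Real.sq_sqrt (by positivity),
    ← ENNReal.ofReal_le_ofReal_iff (by positivity), ENNReal.ofReal_mul (by positivity),
    ENNReal.ofReal_pow (norm_nonneg _), ENNReal.ofReal_pow (norm_nonneg _), ofReal_norm,
    ofReal_norm, enorm_testGradient_sq, enorm_sq_eq_lintegral]
  have hbound := lintegral_sub_ballAverage_sq_le volume (φ := φ) (φ.contDiff.of_le (by simp)) hε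
    Ω.isOpen.measurableSet hs
  rw [finrank_euclideanSpace_fin] at hbound
  refine (lintegral_congr_ae ?_).trans_le hbound
  filter_upwards [Lp.coeFn_sub (testL2 φ) (finiteRankL2 _ s (ballAverage Ω ε) (testL2 φ)),
    coeFn_testL2 φ, coeFn_finiteRankL2 s (ballAverage Ω ε) (testL2 φ)] with x hsub hφ hrank
  rw [hsub, Pi.sub_apply, hφ, hrank, ballAverage_testL2]

theorem norm_formEmbedding_H10_sub_finiteRankL2_comp_le
    [IsFiniteMeasure (volume.restrict (Ω : Set (EuclideanSpace ℝ (Fin d))))] {ε : ℝ} (hε : 0 < ε)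
    {s : SimpleFunc (EuclideanSpace ℝ (Fin d)) (EuclideanSpace ℝ (Fin d))}
    (hs : ∀ x ∈ Ω, dist x (s x) ≤ ε) :
    ‖formEmbedding (H10 Ω) - finiteRankL2 _ s (ballAverage Ω ε) ∘L formEmbedding (H10 Ω)‖ ≤
      √(2 ^ d) * (2 * ε) := by
  have hclosure := norm_comp_formEmbedding_topologicalClosure_le (W := LinearMap.range testPair)
    (ContinuousLinearMap.id ℝ _ - finiteRankL2 _ s (ballAverage Ω ε)) (C := √(2 ^ d) * (2 * ε))
    (by positivity) ?_
  · rwa [ContinuousLinearMap.sub_comp, ContinuousLinearMap.id_comp] at hclosure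
  rintro _ ⟨φ, rfl⟩
  exact norm_testL2_sub_finiteRankL2_le hε hs φ

theorem isCompactOperator_formEmbedding_H10
    (hΩ : Bornology.IsBounded (Ω : Set (EuclideanSpace ℝ (Fin d)))) :
    IsCompactOperator (formEmbedding (H10 Ω)) := by
  have : IsFiniteMeasure (volume.restrict (Ω : Set (EuclideanSpace ℝ (Fin d)))) :=
    isFiniteMeasure_restrict.2 hΩ.measure_lt_top.ne
  refine isCompactOperator_of_forall_exists_norm_sub_le fun δ hδ => ?_
  obtain ⟨ε, hε, rfl⟩ : ∃ ε > 0, √(2 ^ d) * (2 * ε) = δ :=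
    ⟨δ / (√(2 ^ d) * 2), by positivity, by field_simp⟩
  obtain ⟨s, hs⟩ := exists_simpleFunc_dist_lt
    (hΩ.isCompact_closure.totallyBounded.subset subset_closure) hε
  exact ⟨finiteRankL2 _ s (ballAverage Ω ε) ∘L formEmbedding (H10 Ω),
    (isCompactOperator_finiteRankL2 _ _).comp_clm _,
    norm_formEmbedding_H10_sub_finiteRankL2_comp_le hε fun x hx => (hs x hx).le⟩

end Rellich

section Spectrum

theorem not_finiteDimensional_L2_of_pairwise_disjoint {α ι : Type*} [MeasurableSpace α]
    {μ : Measure α} [Infinite ι] {U : ι → Set α} (hU : ∀ i, MeasurableSet (U i))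
    (hne : ∀ i, μ (U i) ≠ 0) (hfin : ∀ i, μ (U i) ≠ ∞)
    (hdisj : Pairwise (Function.onFun Disjoint U)) : ¬ FiniteDimensional ℝ (Lp ℝ 2 μ) := by
  have hinner (i j : ι) : inner ℝ (indicatorConstLp 2 (hU i) (hfin i) (1 : ℝ))
      (indicatorConstLp 2 (hU j) (hfin j) (1 : ℝ)) = μ.real (U i ∩ U j) :=
    L2.real_inner_indicatorConstLp_one_indicatorConstLp_one (hU i) (hU j)
      (hμs := hfin i) (hμt := hfin j)
  have hli : LinearIndependent ℝ fun i => indicatorConstLp 2 (hU i) (hfin i) (1 : ℝ) := by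
    refine linearIndependent_of_ne_zero_of_inner_eq_zero (𝕜 := ℝ) (fun i hi => ?_)
      fun i j hij => ?_
    · have hself := hinner i i
      rw [hi, inner_zero_left, Set.inter_self] at hself
      exact (ENNReal.toReal_pos (hne i) (hfin i)).ne hself
    · exact (hinner i j).trans (by rw [(hdisj hij).inter_eq, measureReal_empty])
  exact fun _ => not_finite_iff_infinite.2 ‹_› hli.finite

variable {d : ℕ} {Ω : TopologicalSpace.Opens (EuclideanSpace ℝ (Fin d))}

theorem not_finiteDimensional_L2 (hd : 1 ≤ d)
    (hne : (Ω : Set (EuclideanSpace ℝ (Fin d))).Nonempty)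
    (hΩ : Bornology.IsBounded (Ω : Set (EuclideanSpace ℝ (Fin d)))) :
    ¬ FiniteDimensional ℝ (L2 Ω) := by
  have : Nonempty (Fin d) := ⟨⟨0, hd⟩⟩
  have : Infinite Ω := by
    obtain ⟨x, hx⟩ := hne
    exact (infinite_of_mem_nhds x (Ω.isOpen.mem_nhds hx)).to_subtype
  obtain ⟨U, hUinf, hUopen, hUdisj⟩ := exists_seq_infinite_isOpen_pairwise_disjoint Ω
  have hopen (n : ℕ) : IsOpen (Subtype.val '' U n) :=
    Ω.isOpen.isOpenEmbedding_subtypeVal.isOpenMap _ (hUopen n)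
  have hsub (n : ℕ) : Subtype.val '' U n ⊆ (Ω : Set (EuclideanSpace ℝ (Fin d))) :=
    Subtype.coe_image_subset _ _
  have hmeasure (n : ℕ) : volume.restrict (Ω : Set (EuclideanSpace ℝ (Fin d)))
      (Subtype.val '' U n) = volume (Subtype.val '' U n) :=
    Measure.restrict_eq_self _ (hsub n)
  refine not_finiteDimensional_L2_of_pairwise_disjoint (fun n => (hopen n).measurableSet)
    (fun n => ?_) (fun n => ?_) fun i j hij =>
      (Set.disjoint_image_iff Subtype.val_injective).2 (hUdisj hij)
  · rw [hmeasure]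
    exact ((hopen n).measure_pos _ ((hUinf n).nonempty.image _)).ne'
  · rw [hmeasure]
    exact ((measure_mono (hsub n)).trans_lt hΩ.measure_lt_top).ne

/-- The Hilbert basis `e` consists of eigenfunctions of `-Δ` with eigenvalues `lam`, and the domain
of `Δ` is as large as these coordinates allow. -/
def IsDirichletEigenbasis {ι : Type*} (e : HilbertBasis ι ℝ (L2 Ω)) (lam : ι → ℝ) : Prop :=
  ∀ u f, HasDirichletLaplacian Ω u f ↔ ∀ i, inner ℝ (e i) f = -lam i * inner ℝ (e i) u

theorem IsDirichletEigenbasis.isDirichletEigenfunction {ι : Type*} {e : HilbertBasis ι ℝ (L2 Ω)}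
    {lam : ι → ℝ} (he : IsDirichletEigenbasis e lam) (i : ι) :
    IsDirichletEigenfunction Ω (lam i) (e i) := by
  refine ⟨e.orthonormal.ne_zero i, (he _ _).2 fun j => ?_⟩
  rw [inner_neg_right, real_inner_smul_right]
  rcases eq_or_ne j i with rfl | hji
  · rw [neg_mul]
  · rw [e.orthonormal.2 hji, mul_zero, mul_zero, neg_zero]

theorem exists_isDirichletEigenbasis (hd : 1 ≤ d)
    (hne : (Ω : Set (EuclideanSpace ℝ (Fin d))).Nonempty)
    (hΩ : Bornology.IsBounded (Ω : Set (EuclideanSpace ℝ (Fin d)))) :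
    ∃ (ι : Type) (e : HilbertBasis ι ℝ (L2 Ω)) (lam : ι → ℝ),
      IsDirichletEigenbasis e lam ∧ (∀ i, 0 ≤ lam i) ∧ ∀ C, ∃ i, C < lam i := by
  obtain ⟨ι, e, lam, hnonneg, hdiag, hunbounded⟩ := exists_eigenbasis_of_isFormOperator
    (isCompactOperator_formEmbedding_H10 hΩ) denseRange_formEmbedding_H10
  exact ⟨ι, e, lam, fun u f => hasDirichletLaplacian_iff_isFormOperator.trans (hdiag u f), hnonneg,
    hunbounded (not_finiteDimensional_L2 hd hne hΩ)⟩

end Spectrum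

section ComplexCoordinates

variable {ι H : Type*} [NormedAddCommGroup H] [InnerProductSpace ℝ H]

theorem hasSum_norm_sq {E : ι → Type*} [∀ i, NormedAddCommGroup (E i)] (f : lp E 2) :
    HasSum (fun i => ‖f i‖ ^ 2) (‖f‖ ^ 2) := by
  simpa using lp.hasSum_norm (p := 2) (by simp) f

theorem hasSum_norm_coordinates_sq (e : HilbertBasis ι ℝ H) (z : WithLp 2 (H × H)) :
    HasSum (fun i => ‖(⟨inner ℝ (e i) z.fst, inner ℝ (e i) z.snd⟩ : ℂ)‖ ^ 2) (‖z‖ ^ 2) := by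
  rw [WithLp.prod_norm_sq_eq_of_L2, ← real_inner_self_eq_norm_sq, ← real_inner_self_eq_norm_sq]
  refine ((e.hasSum_inner_mul_inner z.fst z.fst).add
    (e.hasSum_inner_mul_inner z.snd z.snd)).congr_fun fun i => ?_
  rw [Complex.sq_norm, Complex.normSq_mk, real_inner_comm (e i), real_inner_comm (e i)]

/-- The pair `(z₁, z₂)` seen as the complex vector `z₁ + i z₂`, in the coordinates given by the
Hilbert basis `e`. -/
noncomputable def complexCoordinates (e : HilbertBasis ι ℝ H) :
    WithLp 2 (H × H) ≃ₗᵢ[ℝ] lp (fun _ : ι => ℂ) 2 :=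
  LinearIsometryEquiv.ofSurjective
    { toFun := fun z => ⟨fun i => ⟨inner ℝ (e i) z.fst, inner ℝ (e i) z.snd⟩,
        memℓp_gen (by simpa using (hasSum_norm_coordinates_sq e z).summable)⟩
      map_add' := fun z w => lp.ext <| funext fun i =>
        Complex.ext (inner_add_right _ _ _) (inner_add_right _ _ _)
      map_smul' := fun c z => lp.ext <| funext fun i => by
        simp [Complex.ext_iff, real_inner_smul_right]
      norm_map' := fun z => by
        exact (sq_eq_sq₀ (norm_nonneg _) (norm_nonneg _)).1
          ((hasSum_norm_sq _).unique (hasSum_norm_coordinates_sq e z)) }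
    fun f => by
      let u : lp (fun _ : ι => ℝ) 2 :=
        ⟨fun i => (f i).re, (lp.memℓp f).mono' fun i => Complex.abs_re_le_norm (f i)⟩
      let v : lp (fun _ : ι => ℝ) 2 :=
        ⟨fun i => (f i).im, (lp.memℓp f).mono' fun i => Complex.abs_im_le_norm (f i)⟩
      refine ⟨WithLp.toLp 2 (e.repr.symm u, e.repr.symm v), lp.ext <| funext fun i => ?_⟩
      refine Complex.ext ?_ ?_
      · exact (e.repr_apply_apply _ i).symm.trans (by rw [WithLp.toLp_fst, e.repr.apply_symm_apply])
      · exact (e.repr_apply_apply _ i).symm.trans (by rw [WithLp.toLp_snd, e.repr.apply_symm_apply])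

@[simp]
theorem complexCoordinates_apply (e : HilbertBasis ι ℝ H) (z : WithLp 2 (H × H)) (i : ι) :
    complexCoordinates e z i = ⟨inner ℝ (e i) z.fst, inner ℝ (e i) z.snd⟩ :=
  rfl

theorem complexCoordinates_toLp_smul [DecidableEq ι] (e : HilbertBasis ι ℝ H) (i : ι) (v : ℂ) :
    complexCoordinates e (WithLp.toLp 2 (v.re • e i, v.im • e i)) = lp.single 2 i v := by
  refine lp.ext <| funext fun j => ?_
  rw [complexCoordinates_apply, WithLp.toLp_fst, WithLp.toLp_snd, real_inner_smul_right,
    real_inner_smul_right, lp.single_apply]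
  rcases eq_or_ne j i with rfl | hji
  · simp [e.orthonormal.1 j]
  · simp [e.orthonormal.2 hji, hji, Complex.ext_iff]

end ComplexCoordinates

section CoupledLaplacian

variable {d : ℕ} {Ω : TopologicalSpace.Opens (EuclideanSpace ℝ (Fin d))} {ι : Type*}
  {e : HilbertBasis ι ℝ (L2 Ω)} {lam : ι → ℝ} {a b : ℝ}

theorem eq_smul_sub_smul_and_eq_smul_add_smul_iff {M : Type*} [AddCommGroup M] [Module ℝ M]
    (hab : a ^ 2 + b ^ 2 ≠ 0) {x y p q : M} :
    p = a • x - b • y ∧ q = b • x + a • y ↔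
      x = (a ^ 2 + b ^ 2)⁻¹ • (a • p + b • q) ∧ y = (a ^ 2 + b ^ 2)⁻¹ • (a • q - b • p) := by
  constructor
  · rintro ⟨rfl, rfl⟩
    constructor <;> match_scalars <;> field_simp <;> ring
  · rintro ⟨rfl, rfl⟩
    constructor <;> match_scalars <;> field_simp <;> ring

theorem hasCoupledLaplacian_iff (hab : a ^ 2 + b ^ 2 ≠ 0) {z w : State Ω} :
    HasCoupledLaplacian Ω a b z w ↔
      HasDirichletLaplacian Ω z.fst ((a ^ 2 + b ^ 2)⁻¹ • (a • w.fst + b • w.snd)) ∧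
      HasDirichletLaplacian Ω z.snd ((a ^ 2 + b ^ 2)⁻¹ • (a • w.snd - b • w.fst)) := by
  constructor
  · rintro ⟨f₁, f₂, h₁, h₂, rfl⟩
    obtain ⟨hf₁, hf₂⟩ := (eq_smul_sub_smul_and_eq_smul_add_smul_iff hab
      (x := f₁) (y := f₂)).1 ⟨rfl, rfl⟩
    exact ⟨hf₁ ▸ h₁, hf₂ ▸ h₂⟩
  · rintro ⟨h₁, h₂⟩
    obtain ⟨hw₁, hw₂⟩ := (eq_smul_sub_smul_and_eq_smul_add_smul_iff hab
      (p := w.fst) (q := w.snd)).2 ⟨rfl, rfl⟩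
    exact ⟨_, _, h₁, h₂, WithLp.ofLp_injective 2 (Prod.ext hw₁ hw₂)⟩

/-- `(a, -b; b, a)` is multiplication by `a + ib` in the coordinate `z₁ + i z₂`. -/
theorem IsDirichletEigenbasis.isDiagonalOperator (he : IsDirichletEigenbasis e lam)
    (hab : a ^ 2 + b ^ 2 ≠ 0) :
    IsDiagonalOperator (complexCoordinates e).toContinuousLinearEquiv
      (fun i => -lam i * (a + b * Complex.I)) (HasCoupledLaplacian Ω a b) := by
  intro z w
  rw [hasCoupledLaplacian_iff hab, he, he, ← forall_and]
  refine forall_congr' fun i => ?_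
  have hsolve := eq_smul_sub_smul_and_eq_smul_add_smul_iff hab
    (x := -lam i * inner ℝ (e i) z.fst) (y := -lam i * inner ℝ (e i) z.snd)
    (p := inner ℝ (e i) w.fst) (q := inner ℝ (e i) w.snd)
  simp only [real_inner_smul_right, inner_add_right, inner_sub_right]
  rw [eq_comm, eq_comm (b := -lam i * inner ℝ (e i) z.snd)]
  refine hsolve.symm.trans ?_
  simp only [neg_mul, smul_eq_mul, mul_neg, sub_neg_eq_add,
    LinearIsometryEquiv.coe_toContinuousLinearEquiv, complexCoordinates_apply, Complex.ext_iff,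
    Complex.neg_re, Complex.mul_re, Complex.ofReal_re, Complex.add_re, Complex.I_re, mul_zero,
    Complex.ofReal_im, Complex.I_im, mul_one, sub_self, add_zero, Complex.add_im, Complex.mul_im,
    zero_add, zero_mul, sub_zero, neg_sub, Complex.neg_im, neg_add_rev]
  ring_nf

theorem IsDirichletEigenbasis.existsUnique_semigroup (he : IsDirichletEigenbasis e lam)
    (hlam : ∀ i, 0 ≤ lam i) (ha : 0 ≤ a) (hab : a ^ 2 + b ^ 2 ≠ 0) :
    ∃! S : ℝ≥0 → State Ω →L[ℝ] State Ω, IsSemigroupGeneratedBy (HasCoupledLaplacian Ω a b) S := by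
  have hdiag := he.isDiagonalOperator hab
  obtain ⟨S, hS⟩ := hdiag.exists_semigroup ENNReal.ofNat_ne_top fun i => by
    simpa using mul_nonneg (hlam i) ha
  exact ⟨S, hS, fun R hR => hdiag.semigroup_unique ENNReal.ofNat_ne_top hR hS⟩

/-- The state `v e` of `L²(Ω; ℝ²) ≅ L²(Ω; ℂ)`. -/
noncomputable def mode (e : L2 Ω) (v : ℂ) : State Ω :=
  mkState (v.re • e) (v.im • e)

@[simp]
theorem observe_mode (e : L2 Ω) (v : ℂ) : observe (mode e v) = v.re • e :=
  rfl

theorem mode_eq_zero_iff {e : L2 Ω} (he : e ≠ 0) {v : ℂ} : mode e v = 0 ↔ v = 0 := by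
  rw [mode, mkState, WithLp.toLp_eq_zero, Prod.mk_eq_zero, smul_eq_zero_iff_left he,
    smul_eq_zero_iff_left he, Complex.ext_iff, Complex.zero_re, Complex.zero_im]

theorem IsDirichletEigenbasis.semigroup_mode (he : IsDirichletEigenbasis e lam)
    (hab : a ^ 2 + b ^ 2 ≠ 0) {S : ℝ≥0 → State Ω →L[ℝ] State Ω}
    (hS : IsSemigroupGeneratedBy (HasCoupledLaplacian Ω a b) S) (i : ι) (v : ℂ) (t : ℝ≥0) :
    S t (mode (e i) v) =
      mode (e i) (Complex.exp (t * (-lam i * (a + b * Complex.I))) * v) := by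
  classical
  have hmode (v : ℂ) : (complexCoordinates e).toContinuousLinearEquiv.symm (lp.single 2 i v) =
      mode (e i) v :=
    (ContinuousLinearEquiv.symm_apply_eq _).2 (complexCoordinates_toLp_smul e i v).symm
  simpa only [hmode] using (he.isDiagonalOperator hab).semigroup_apply_single hS t i v

end CoupledLaplacian

section UnobservableModes

theorem pos_and_mul_abs_two_pi_div_lt {b l ε : ℝ} (hb : b ≠ 0) (hε : 0 < ε) (m : ℕ)
    (hl : m * (2 * Real.pi) / (|b| * ε) < l) : 0 < l ∧ m * |2 * Real.pi / (b * l)| < ε := by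
  have hb' : 0 < |b| := abs_pos.2 hb
  have hl0 : 0 < l := lt_of_le_of_lt (by positivity) hl
  refine ⟨hl0, ?_⟩
  rw [div_lt_iff₀ (by positivity)] at hl
  rw [abs_div, abs_mul b, abs_of_pos Real.two_pi_pos, abs_of_pos hl0, ← mul_div_assoc,
    div_lt_iff₀ (by positivity)]
  linarith

/-- The initial phase `exp (-sμ) i` makes the mode purely imaginary at time `s`, hence also after
every multiple of the period. -/
theorem re_exp_mul_eq_zero {a b l : ℝ} (hb : b ≠ 0) (hl : l ≠ 0) {s t : ℝ} (k : ℕ)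
    (ht : t = s + k * (2 * Real.pi / (b * l))) :
    (Complex.exp (t * (-l * (a + b * Complex.I))) *
      (Complex.exp (-(s * (-l * (a + b * Complex.I)))) * Complex.I)).re = 0 := by
  have hexponent : (t * (-l * (a + b * Complex.I)) + -(s * (-l * (a + b * Complex.I))) : ℂ) =
      (-(k * (2 * Real.pi / b) * a) : ℝ) - k * (2 * Real.pi * Complex.I) := by
    have hb' : (b : ℂ) ≠ 0 := Complex.ofReal_ne_zero.2 hb
    have hl' : (l : ℂ) ≠ 0 := Complex.ofReal_ne_zero.2 hl
    rw [ht]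
    push_cast
    field_simp
    ring
  rw [← mul_assoc, ← Complex.exp_add, hexponent, Complex.exp_periodic.sub_nat_mul_eq,
    ← Complex.ofReal_exp, Complex.re_ofReal_mul, Complex.I_re, mul_zero]

theorem exists_arithmetic_times {T : ℝ≥0} {m : ℕ} {δ : ℝ} (hδ0 : δ ≠ 0) (hδ : m * |δ| < T / 2) :
    ∃ τ : Fin m → ℝ≥0, Function.Injective τ ∧ (∀ i, τ i ∈ Set.Ioo 0 T) ∧
      ∀ i, (τ i : ℝ) = T / 2 + i * δ := by
  have hsmall (i : Fin m) : |i * δ| < T / 2 := by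
    rw [abs_mul, Nat.abs_cast]
    refine lt_of_le_of_lt ?_ hδ
    gcongr
    exact i.2.le
  have hpos (i : Fin m) : 0 < (T : ℝ) / 2 + i * δ := by
    linarith [(abs_lt.1 (hsmall i)).1]
  refine ⟨fun i => ⟨T / 2 + i * δ, (hpos i).le⟩, fun i j hij => ?_,
    fun i => ⟨hpos i, NNReal.coe_lt_coe.1 ?_⟩, fun _ => rfl⟩
  · exact Fin.ext (Nat.cast_injective
      (mul_right_cancel₀ hδ0 (add_left_cancel (congrArg NNReal.toReal hij))))
  · change (T : ℝ) / 2 + i * δ < T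
    linarith [(abs_lt.1 (hsmall i)).2]

variable {d : ℕ} {Ω : TopologicalSpace.Opens (EuclideanSpace ℝ (Fin d))}

theorem IsDirichletEigenbasis.exists_unobservable_mode {ι : Type*} {e : HilbertBasis ι ℝ (L2 Ω)}
    {lam : ι → ℝ} {a b : ℝ} (he : IsDirichletEigenbasis e lam) (hb : b ≠ 0)
    {S : ℝ≥0 → State Ω →L[ℝ] State Ω} (hS : IsSemigroupGeneratedBy (HasCoupledLaplacian Ω a b) S)
    {k : ι} (hk : lam k ≠ 0) {T : ℝ≥0} {m : ℕ} (hm : m * |2 * Real.pi / (b * lam k)| < T / 2) :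
    ∃ (τ : Fin m → ℝ≥0) (v : ℂ), Function.Injective τ ∧ (∀ i, τ i ∈ Set.Ioo 0 T) ∧
      (∀ i, observe (S (τ i) (mode (e k) v)) = 0) ∧ S T (mode (e k) v) ≠ 0 ∧
      ∀ i j : Fin m, (τ i : ℝ) - τ j = ((i : ℝ) - j) * (2 * Real.pi / (b * lam k)) := by
  have hab : a ^ 2 + b ^ 2 ≠ 0 := by positivity
  obtain ⟨τ, hinj, hmem, hτ⟩ := exists_arithmetic_times (by positivity) hm
  refine ⟨τ, Complex.exp (-((T / 2 : ℝ) * (-lam k * (a + b * Complex.I)))) * Complex.I,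
    hinj, hmem, fun i => ?_, ?_, fun i j => ?_⟩
  · rw [he.semigroup_mode hab hS, observe_mode, re_exp_mul_eq_zero hb hk i (hτ i), zero_smul]
  · simp [he.semigroup_mode hab hS, mode_eq_zero_iff (e.orthonormal.ne_zero k)]
  · rw [hτ, hτ]
    ring

theorem not_interpolationObservability {S : ℝ≥0 → State Ω →L[ℝ] State Ω} {T : ℝ≥0} {m : ℕ}
    {τ : Fin m → ℝ≥0} {z : State Ω} (hz : ∀ i, observe (S (τ i) z) = 0) (hT : S T z ≠ 0)
    {ω : Fin m → Set (EuclideanSpace ℝ (Fin d))}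
    (hω : ∀ i, ω i ⊆ (Ω : Set (EuclideanSpace ℝ (Fin d)))) (p : ℝ≥0∞) {θ : ℝ} (hθ : θ < 1) (C : ℝ) :
    ¬ InterpolationObservability S T τ ω p θ C := by
  intro h
  have hnorm (i : Fin m) : eLpNorm (observe (S (τ i) z)) p (volume.restrict (ω i)) = 0 := by
    rw [hz i, eLpNorm_congr_ae (ae_restrict_of_ae_restrict_of_subset (hω i) (Lp.coeFn_zero ℝ 2 _))]
    exact eLpNorm_zero
  have hle := h z
  simp only [hnorm, ENNReal.toReal_zero, Finset.sum_const_zero] at hle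
  rw [Real.zero_rpow (sub_pos.2 hθ).ne', mul_zero, zero_mul] at hle
  exact hT (norm_le_zero_iff.1 hle)

end UnobservableModes

end StronglyCoupled

open StronglyCoupled in
theorem proposition3p5_general {d : ℕ} (hd : 1 ≤ d)
    (Ω : TopologicalSpace.Opens (EuclideanSpace ℝ (Fin d)))
    (hΩne : (Ω : Set (EuclideanSpace ℝ (Fin d))).Nonempty)
    (hΩbd : Bornology.IsBounded (Ω : Set (EuclideanSpace ℝ (Fin d))))
    (a b : ℝ) (ha : 0 ≤ a) (hb : b ≠ 0) :
    (∃! S : ℝ≥0 → State Ω →L[ℝ] State Ω, IsSemigroupGeneratedBy (HasCoupledLaplacian Ω a b) S) ∧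
    ∀ S : ℝ≥0 → State Ω →L[ℝ] State Ω, IsSemigroupGeneratedBy (HasCoupledLaplacian Ω a b) S →
    ∀ T : ℝ≥0, 0 < T → ∀ m : ℕ,
    ∃ (τ : Fin m → ℝ≥0) (z : State Ω),
      Function.Injective τ ∧ (∀ i, τ i ∈ Set.Ioo 0 T) ∧ z ≠ 0 ∧
      (∀ i, observe (S (τ i) z) = 0) ∧
      (∃ (lam : ℝ) (e : L2 Ω) (v₁ v₂ : ℝ), 0 < lam ∧ IsDirichletEigenfunction Ω lam e ∧
        z = mkState (v₁ • e) (v₂ • e) ∧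
        ∀ i j : Fin m, (τ i : ℝ) - (τ j : ℝ) =
          (((i : ℕ) : ℝ) - ((j : ℕ) : ℝ)) * (2 * Real.pi / (b * lam))) ∧
      (∀ ω : Fin m → Set (EuclideanSpace ℝ (Fin d)),
        (∀ i, ω i ⊆ (Ω : Set (EuclideanSpace ℝ (Fin d)))) → ∀ (p : ℝ≥0∞) (θ : ℝ), θ < 1 → ∀ C : ℝ,
        ¬ InterpolationObservability S T τ ω p θ C) := by
  obtain ⟨ι, e, lam, he, hlam, hunbounded⟩ := exists_isDirichletEigenbasis hd hΩne hΩbd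
  refine ⟨he.existsUnique_semigroup hlam ha (by positivity), fun S hS T hT m => ?_⟩
  obtain ⟨k, hk⟩ := hunbounded (m * (2 * Real.pi) / (|b| * (T / 2)))
  obtain ⟨hpos, hperiod⟩ := pos_and_mul_abs_two_pi_div_lt hb (half_pos (NNReal.coe_pos.2 hT)) m hk
  obtain ⟨τ, v, hinj, hmem, hvanish, hfinal, hspacing⟩ :=
    he.exists_unobservable_mode hb hS hpos.ne' hperiod
  exact ⟨τ, mode (e k) v, hinj, hmem, fun hz => hfinal (by rw [hz, map_zero]), hvanish,
    ⟨lam k, e k, v.re, v.im, hpos, he.isDirichletEigenfunction k, rfl, hspacing⟩,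
    fun ω hω p θ hθ C => not_interpolationObservability hvanish hfinal hω p hθ C⟩

theorem proposition3p5 {d : ℕ} (hd : 1 ≤ d)
    (Ω : TopologicalSpace.Opens (EuclideanSpace ℝ (Fin d)))
    (hΩne : (Ω : Set (EuclideanSpace ℝ (Fin d))).Nonempty)
    (hΩbd : Bornology.IsBounded (Ω : Set (EuclideanSpace ℝ (Fin d))))
    (a b : ℝ) (ha : 0 < a) (hb : b ≠ 0) :
    -- the operator generates one and only one strongly continuous semigroup
    (∃! S : ℝ≥0 → StronglyCoupled.State Ω →L[ℝ] StronglyCoupled.State Ω,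
      StronglyCoupled.IsSemigroupGeneratedBy (StronglyCoupled.HasCoupledLaplacian Ω a b) S) ∧
    ∀ S : ℝ≥0 → StronglyCoupled.State Ω →L[ℝ] StronglyCoupled.State Ω,
      StronglyCoupled.IsSemigroupGeneratedBy (StronglyCoupled.HasCoupledLaplacian Ω a b) S →
    ∀ T : ℝ≥0, 0 < T → ∀ m : ℕ, 1 ≤ m →
    ∃ (τ : Fin m → ℝ≥0) (z : StronglyCoupled.State Ω),
      -- the times are distinct points of `(0, T)`, and `z` is a nonzero state
      Function.Injective τ ∧ (∀ i, τ i ∈ Set.Ioo 0 T) ∧ z ≠ 0 ∧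
      -- the observation of the solution starting at `z` vanishes at all these times
      (∀ i, StronglyCoupled.observe (S (τ i) z) = 0) ∧
      -- `z` is a single eigenmode and the times are spaced by `2π / (b lam)`
      (∃ (lam : ℝ) (e : StronglyCoupled.L2 Ω) (v₁ v₂ : ℝ),
        0 < lam ∧ StronglyCoupled.IsDirichletEigenfunction Ω lam e ∧
        z = StronglyCoupled.mkState (v₁ • e) (v₂ • e) ∧
        ∀ i j : Fin m, (τ i : ℝ) - (τ j : ℝ) =
          (((i : ℕ) : ℝ) - ((j : ℕ) : ℝ)) * (2 * Real.pi / (b * lam))) ∧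
      -- no interpolation observability inequality holds at these times
      (∀ ω : Fin m → Set (EuclideanSpace ℝ (Fin d)),
        (∀ i, ω i ⊆ (Ω : Set (EuclideanSpace ℝ (Fin d))) ∧ NullMeasurableSet (ω i) volume ∧
          0 < volume (ω i)) →
        ∀ p : ℝ≥0∞, 1 ≤ p → p ≤ 2 → ∀ θ : ℝ, θ ∈ Set.Ioo (0 : ℝ) 1 →
        ¬ ∃ C : ℝ, 0 < C ∧
          StronglyCoupled.InterpolationObservability S T τ ω p θ C) := by
  obtain ⟨hex, hunobs⟩ :=
    proposition3p5_general hd Ω hΩne hΩbd a b ha.le hb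
  refine ⟨hex, fun S hS T hT m _ => ?_⟩
  obtain ⟨τ, z, hinj, hmem, hz, hvanish, hmode, hfail⟩ := hunobs S hS T hT m
  exact ⟨τ, z, hinj, hmem, hz, hvanish, hmode, fun ω hω p _ _ θ hθ ⟨C, _, hC⟩ =>
    hfail ω (fun i => (hω i).1) p θ hθ.2 C hC⟩
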